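/- Let $U,V,H$ be real separable Hilbert spaces with $V\hookrightarrow H\hookrightarrow V'$ a Gelfand triple ($V$ continuously and densely embedded in $H$). Let $T>0$, $\theta>0$, and let $\mathfrak S=[-1,1]^{\mathbb N}$ carry the product topology and the countable product of the uniform distributions on $[-1,1]$, with expectation $\mathbb E$. For random variables $X\in L^\infty(\mathfrak S;\mathbb R)$ let $\mathcal R_\theta(X)=\frac1\theta\log\mathbb E[e^{\theta X}]$ be the entropic risk measure. Let $A:\mathfrak S\to\mathcal L(V,V')$ be continuous and uniformly bounded, and suppose that there are $\rho\in\mathbb R$ and $\alpha>0$ with $$-\langle A(\sigma)v,v\rangle_{V',V}+\rho\|v\|_H^2\ge\alpha\|v\|_V^2\qquad\text{for all } v\in V,\ \sigma\in\mathfrak S .$$ Let $B\in\mathcal L(U,H)$, $C,P\in\mathcal L(H)$, $f\in L^2(0,T;V')$, $y_0,g_T\in H$ and $g\in C([0,T];H)$. For $u\in L^2(0,T;U)$ and $\sigma\in\mathfrak S$, a state is a function $y\in L^2(0,T;V)$ with weak derivative $\dot y\in L^2(0,T;V')$, identified with its representative in $C([0,T];H)$, such that $$\dot y=A(\sigma)y+Bu+f\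 \text{ in } L^2(0,T;V'),\qquad y(0)=y_0 .$$ For $u\in L^2(0,T;U)$ and a family $y=(y(\sigma;\cdot))_{\sigma\in\mathfrak S}$ of states for $u$, put $$\mathcal J(u,y)=\frac12\Big(\int_0^T\big(\mathcal R_\theta(\|C(y(\cdot;t)-g(t))\|_H^2)+\|u(t)\|_U^2\big)\,dt+\mathcal R_\theta(\|P(y(\cdot;T)-g_T)\|_H^2)\Big).$$ Then: 1. For all $u$ and $\sigma$ there is exactly one state $y_u(\sigma;\cdot)\in C([0,T];H)$, and $\sigma\mapsto y_u(\sigma;\cdot)\in C([0,T];H)$ is continuous. All integrals in $J(u):=\mathcal J(u,y_u)$ exist. 2. $J:L^2(0,T;U)\to\mathbb R$ is continuous and coercive, with $J(u)\ge\frac12\|u\|^2_{L^2(0,T;U)}$, and strongly convex with modulus $1$, that is, for all $u,w$ and $\lambda\in[0,1]$, $$J(\lambda u+(1-\lambda)w)\le\lambda J(u)+(1-\lambda)J(w)-\tfrac12\lambda(1-\lambda)\|u-w\|^2_{L^2(0,T;U)} .$$ 3. $J$ has a unique minimizer in $L^2(0,T;U)$. 4. Equivalently, the problem of minimizing $\mathcal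 J(u,y)$ over all pairs $(u,y)$ such that $y(\sigma;\cdot)$ is a state for $u$ for every $\sigma\in\mathfrak S$ has a unique solution. -/

import Mathlib

open MeasureTheory Set
open scoped ENNReal ContDiff

namespace RiskAverse

noncomputable section

/-- The parameter domain `[-1,1]^ℕ`, with the product topology and the product σ-algebra. -/
abbrev Param : Type := ℕ → Set.Icc (-1 : ℝ) 1

/-- The uniform distribution `dσ / 2` on `[-1,1]`. -/
def uniformMeasure : Measure (Set.Icc (-1 : ℝ) 1) :=
  (2 : ℝ≥0∞)⁻¹ • (volume : Measure ℝ).comap Subtype.val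

instance uniformMeasure_isProbabilityMeasure : IsProbabilityMeasure uniformMeasure := by
  constructor
  have h : ((volume : Measure ℝ).comap Subtype.val :
      Measure (Set.Icc (-1 : ℝ) 1)) Set.univ = 2 := by
    rw [comap_subtype_coe_apply measurableSet_Icc, Set.image_univ, Subtype.range_coe,
      Real.volume_Icc]
    norm_num
  rw [uniformMeasure, Measure.smul_apply, h, smul_eq_mul]
  exact ENNReal.inv_mul_cancel (by norm_num) (by norm_num)

/-- The law of the parameter sequence: the countable product of the uniform distributions. -/
def paramMeasure : Measure Param := Measure.infinitePi (fun _ : ℕ => uniformMeasure)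

/-- The entropic risk measure `(1/θ) log 𝔼[exp(θ X)]`. -/
def entropicRisk (θ : ℝ) (X : Param → ℝ) : ℝ :=
  1 / θ * Real.log (∫ σ, Real.exp (θ * X σ) ∂paramMeasure)

/-- Lebesgue measure on the time interval `(0,T)`. -/
abbrev timeMeasure (T : ℝ) : Measure ℝ := volume.restrict (Set.Ioo 0 T)

/-- The Bochner space `L²(0,T;X)`. -/
abbrev L2 (T : ℝ) (X : Type*) [NormedAddCommGroup X] : Type _ := Lp X 2 (timeMeasure T)

/-- `z` is the weak (distributional) derivative of `w` on `(0,T)`. -/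
def HasWeakTimeDeriv {E : Type*} [NormedAddCommGroup E] [NormedSpace ℝ E]
    (T : ℝ) (w z : ℝ → E) : Prop :=
  ∀ φ : ℝ → ℝ, ContDiff ℝ ∞ φ → HasCompactSupport φ → tsupport φ ⊆ Set.Ioo 0 T →
    ∫ t in Set.Ioo 0 T, deriv φ t • w t = -∫ t in Set.Ioo 0 T, φ t • z t

variable (U V H : Type*)
  [NormedAddCommGroup U] [InnerProductSpace ℝ U]
  [NormedAddCommGroup V] [InnerProductSpace ℝ V]
  [NormedAddCommGroup H] [InnerProductSpace ℝ H]

/-- The data of the optimal control problem. -/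
structure Problem where
  /-- the time horizon -/
  T : ℝ
  T_pos : 0 < T
  /-- the risk-aversion parameter -/
  θ : ℝ
  θ_pos : 0 < θ
  /-- the embedding of `V` into the pivot space `H` -/
  ι : V →L[ℝ] H
  ι_injective : Function.Injective ι
  ι_denseRange : DenseRange ι
  /-- the operators `A(σ) ∈ L(V, V')` -/
  A : Param → V →L[ℝ] StrongDual ℝ V
  A_continuous : Continuous A
  /-- with `a(σ;v,w) = -⟨A(σ)v, w⟩`:  `a(σ;v,v) + ρ ‖v‖_H² ≥ α ‖v‖_V²`, uniformly in `σ` -/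
  A_coercive : ∃ ρ α : ℝ, 0 < α ∧ ∀ (σ : Param) (v : V),
    α * ‖v‖ ^ 2 ≤ -(A σ v v) + ρ * ‖ι v‖ ^ 2
  A_bounded : ∃ c : ℝ, ∀ σ : Param, ‖A σ‖ ≤ c
  B : U →L[ℝ] H
  /-- the observation operators and the targets -/
  C : H →L[ℝ] H
  P : H →L[ℝ] H
  g : C(Set.Icc (0 : ℝ) T, H)
  gT : H
  f : L2 T (StrongDual ℝ V)
  y₀ : H

namespace Problem

variable {U V H}
variable (Q : Problem U V H)

/-- The embedding `H → V'`, `h ↦ ⟨h, ι ·⟩_H`, of the Gelfand triple. -/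
def toDual (h : H) : StrongDual ℝ V := (innerSL ℝ h).comp Q.ι

/-- A trajectory `[0,T] → H`, extended by constants so that it can be evaluated at every real. -/
def eval (y : C(Set.Icc (0 : ℝ) Q.T, H)) (t : ℝ) : H := Set.IccExtend Q.T_pos.le y t

/-- `y` is the solution in `W(0,T;V,V')`, through its representative in `C([0,T];H)`, of
`ẏ = A(σ) y + B u + f` in `L²(0,T;V')`, `y(0) = y₀`: here `v` is `y` as an element of `L²(0,T;V)`
and `dv ∈ L²(0,T;V')` is its weak time derivative. -/
def IsState (σ : Param) (u : L2 Q.T U) (y : C(Set.Icc (0 : ℝ) Q.T, H)) : Prop :=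
  ∃ (v : L2 Q.T V) (dv : L2 Q.T (StrongDual ℝ V)),
    HasWeakTimeDeriv Q.T (fun t => Q.toDual (Q.ι (v t))) (fun t => dv t) ∧
    (∀ᵐ t ∂timeMeasure Q.T, Q.ι (v t) = Q.eval y t) ∧
    (∀ᵐ t ∂timeMeasure Q.T, dv t = Q.A σ (v t) + Q.toDual (Q.B (u t)) + Q.f t) ∧
    Q.eval y 0 = Q.y₀

/-- The state `y_u(σ)` belonging to the control `u`: the function satisfying `IsState`. -/
def state (u : L2 Q.T U) (σ : Param) : C(Set.Icc (0 : ℝ) Q.T, H) :=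
  Classical.epsilon (fun y => Q.IsState σ u y)

/-- The integrand of the running cost. -/
def runningCost (u : L2 Q.T U) (y : Param → C(Set.Icc (0 : ℝ) Q.T, H)) (t : ℝ) : ℝ :=
  entropicRisk Q.θ (fun σ => ‖Q.C (Q.eval (y σ) t - Q.eval Q.g t)‖ ^ 2) + ‖u t‖ ^ 2

/-- The cost functional of a control and a parametric family of trajectories. -/
def cost (u : L2 Q.T U) (y : Param → C(Set.Icc (0 : ℝ) Q.T, H)) : ℝ :=
  1 / 2 * ((∫ t in Set.Ioo 0 Q.T, Q.runningCost u y t) +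
    entropicRisk Q.θ (fun σ => ‖Q.P (Q.eval (y σ) Q.T - Q.gT)‖ ^ 2))

/-- The reduced cost functional `J(u)`. -/
def reducedCost (u : L2 Q.T U) : ℝ := Q.cost u (Q.state u)

/-- Feasible pairs of the original problem: `y(σ)` is the state of `u` for every `σ`. -/
def Feasible (p : L2 Q.T U × (Param → C(Set.Icc (0 : ℝ) Q.T, H))) : Prop :=
  ∀ σ : Param, Q.IsState σ p.1 (p.2 σ)

end Problem

end

end RiskAverse

/-! The Riesz isomorphism and `toDual_eq` turn the state equation into `(ι†ι v)' = a v + F` in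
`L²(0,T;V)`, where `a` is the operator `opA`. The regular functions `v = y₀ + ∫₀ᵗ x`, with `x`
bounded and continuous in `V`, solve this equation classically for the data `F = ι†ι x - a v`. On
them an energy estimate (`norm_regSol_le`) bounds `v` in `L²(0,T;V)` and `ι v` in `C([0,T];H)` by
the data. If these data are dense in `L²(0,T;V) × H`, the solution map extends to a bounded operator
`solOp`, and the weak formulation passes to limits.

Density (`denseRange_of_accretive`) and uniqueness (`eq_zero_of_accretive`) are Hilbert space
arguments. They rest on one fact: the Volterra operator `L` with kernel `exp (-ρ (t - s))` satisfies
`ρ ‖L x‖² ≤ ⟪x, L x⟫` and commutes with operators constant in time. For uniqueness, the lemma of du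
Bois-Reymond first integrates the weak equation.

The a priori constant depends only on `T`, `α` and `ρ`. States are therefore Lipschitz in `u`
uniformly in `σ`, and a perturbation identity makes them continuous in `σ`. They are also affine in
`u`. The entropic risk is monotone, convex and translation equivariant, hence 1-Lipschitz in the sup
norm. So the risk terms of `J` are nonnegative, convex and continuous, and `½ ‖u‖²` supplies
coercivity and modulus 1. Strong convexity makes minimizing sequences Cauchy, which gives the unique
minimizer. -/

namespace RiskAverse

open scoped RealInnerProductSpace Topology BoundedContinuousFunction InnerProduct

/-! ### Operators on `L²(0,T;E)`: primitives, multipliers, operators constant in time. -/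

section Operators

variable {E F : Type*} [NormedAddCommGroup E] [NormedSpace ℝ E]
  [NormedAddCommGroup F] [NormedSpace ℝ F] {T : ℝ}

omit [NormedSpace ℝ E] in
theorem integrable_coe (x : L2 T E) : Integrable x (timeMeasure T) :=
  (Lp.memLp x).integrable one_le_two

theorem exists_integral_norm_le (T : ℝ) (E : Type*) [NormedAddCommGroup E] :
    ∃ K : ℝ, ∀ x : L2 T E, ∫ t, ‖x t‖ ∂timeMeasure T ≤ K * ‖x‖ := by
  refine ⟨((timeMeasure T univ) ^ (1 / (1 : ℝ) - 1 / (2 : ℝ))).toReal, fun x => ?_⟩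
  have h := eLpNorm_le_eLpNorm_mul_rpow_measure_univ (p := 1) (q := 2) (μ := timeMeasure T)
    one_le_two (Lp.aestronglyMeasurable x)
  rw [integral_norm_eq_lintegral_enorm (Lp.aestronglyMeasurable x),
    ← eLpNorm_one_eq_lintegral_enorm, Lp.norm_def, mul_comm, ← ENNReal.toReal_mul]
  refine ENNReal.toReal_mono (ENNReal.mul_ne_top (Lp.eLpNorm_ne_top x) ?_) (by simpa using h)
  exact ENNReal.rpow_ne_top_of_nonneg (by norm_num) (measure_ne_top _ _)

theorem norm_intervalIntegral_le (x : L2 T E) (a b : ℝ) :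
    ‖∫ s in a..b, x s ∂timeMeasure T‖ ≤ ∫ t, ‖x t‖ ∂timeMeasure T :=
  intervalIntegral.norm_integral_le_integral_norm_uIoc.trans
    (setIntegral_le_integral (integrable_coe x).norm (Filter.Eventually.of_forall fun _ =>
      norm_nonneg _))

/-- The primitive `t ↦ ∫₀ᵗ x` of an `L²` function as a continuous function. -/
noncomputable def primC (T : ℝ) (E : Type*) [NormedAddCommGroup E] [NormedSpace ℝ E] :
    L2 T E →L[ℝ] C(Set.Icc (0 : ℝ) T, E) :=
  LinearMap.mkContinuousOfExistsBound
    { toFun := fun x => ⟨fun t => ∫ s in (0 : ℝ)..t, x s ∂timeMeasure T,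
        (intervalIntegral.continuous_primitive
          (fun a b => (integrable_coe x).intervalIntegrable) 0).comp continuous_subtype_val⟩
      map_add' := fun x y => by
        ext t
        simp only [ContinuousMap.coe_mk, ContinuousMap.add_apply]
        rw [← intervalIntegral.integral_add (integrable_coe x).intervalIntegrable
          (integrable_coe y).intervalIntegrable]
        refine intervalIntegral.integral_congr_ae_restrict (ae_restrict_of_ae ?_)
        exact Lp.coeFn_add x y
      map_smul' := fun c x => by
        ext t
        simp only [ContinuousMap.coe_mk, ContinuousMap.smul_apply, RingHom.id_apply]
        rw [← intervalIntegral.integral_smul]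
        refine intervalIntegral.integral_congr_ae_restrict (ae_restrict_of_ae ?_)
        exact Lp.coeFn_smul c x }
    (by
      obtain ⟨K, hK⟩ := exists_integral_norm_le T E
      refine ⟨K, fun x => ?_⟩
      have h0 : 0 ≤ K * ‖x‖ := (integral_nonneg fun _ => norm_nonneg _).trans (hK x)
      exact (ContinuousMap.norm_le _ h0).2 fun t => (norm_intervalIntegral_le x 0 t).trans (hK x))

theorem primC_apply (x : L2 T E) (t : Set.Icc (0 : ℝ) T) :
    primC T E x t = ∫ s in (0 : ℝ)..t, x s ∂timeMeasure T := rfl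

/-- Constant extension of a continuous function from `[0,T]` to `ℝ`. -/
noncomputable def extB (hT : 0 ≤ T) (E : Type*) [NormedAddCommGroup E] [NormedSpace ℝ E] :
    C(Set.Icc (0 : ℝ) T, E) →L[ℝ] (ℝ →ᵇ E) :=
  LinearMap.mkContinuous
    { toFun := fun y => (BoundedContinuousFunction.mkOfCompact y).compContinuous
        ⟨Set.projIcc 0 T hT, continuous_projIcc⟩
      map_add' := fun _ _ => rfl
      map_smul' := fun _ _ => rfl } 1 (fun y => by
        rw [one_mul]
        exact (BoundedContinuousFunction.norm_le (norm_nonneg _)).2 fun t => y.norm_coe_le_norm _)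

/-- The inclusion of the bounded continuous functions into `L²`. -/
noncomputable def bcfLp (T : ℝ) (E : Type*) [NormedAddCommGroup E] [NormedSpace ℝ E] :
    (ℝ →ᵇ E) →L[ℝ] L2 T E :=
  BoundedContinuousFunction.toLp 2 (timeMeasure T) ℝ

theorem coeFn_bcfLp (x : ℝ →ᵇ E) : bcfLp T E x =ᵐ[timeMeasure T] x :=
  BoundedContinuousFunction.coeFn_toLp (𝕜 := ℝ) 2 (timeMeasure T) x

theorem bcfLp_denseRange (T : ℝ) (E : Type*) [NormedAddCommGroup E] [NormedSpace ℝ E] :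
    DenseRange (bcfLp T E) :=
  BoundedContinuousFunction.toLp_denseRange E (timeMeasure T) ℝ (by norm_num)

/-- The inclusion of `C([0,T];E)` into `L²(0,T;E)`. -/
noncomputable def contLp (hT : 0 ≤ T) (E : Type*) [NormedAddCommGroup E] [NormedSpace ℝ E] :
    C(Set.Icc (0 : ℝ) T, E) →L[ℝ] L2 T E := (bcfLp T E).comp (extB hT E)

theorem coeFn_contLp (hT : 0 ≤ T) (y : C(Set.Icc (0 : ℝ) T, E)) :
    contLp hT E y =ᵐ[timeMeasure T] Set.IccExtend hT y :=
  coeFn_bcfLp _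

/-- The Volterra operator. -/
noncomputable def volterra (hT : 0 ≤ T) (E : Type*) [NormedAddCommGroup E] [NormedSpace ℝ E] :
    L2 T E →L[ℝ] L2 T E := (contLp hT E).comp (primC T E)

theorem coeFn_volterra (hT : 0 ≤ T) (x : L2 T E) :
    volterra hT E x =ᵐ[timeMeasure T] fun t => ∫ s in (0 : ℝ)..t, x s ∂timeMeasure T := by
  have h := coeFn_contLp hT (primC T E x)
  filter_upwards [h, ae_restrict_mem measurableSet_Ioo] with t ht hmem
  rw [volterra, ContinuousLinearMap.comp_apply, ht,
    Set.IccExtend_of_mem _ _ (Ioo_subset_Icc_self hmem), primC_apply]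

theorem memLp_mul {c : ℝ → ℝ} (hc : Continuous c) (x : L2 T E) :
    MemLp (fun t => c t • x t) 2 (timeMeasure T) := by
  obtain ⟨K, hK⟩ := isCompact_Icc.exists_bound_of_continuousOn (s := Icc 0 T) hc.continuousOn
  refine (Lp.memLp x).of_le_mul (c := K)
    (hc.aestronglyMeasurable.smul (Lp.aestronglyMeasurable x)) ?_
  filter_upwards [ae_restrict_mem measurableSet_Ioo] with t ht
  rw [norm_smul]
  gcongr
  exact hK t (Ioo_subset_Icc_self ht)

/-- Multiplication by a continuous function. -/
noncomputable def mulLp (T : ℝ) (E : Type*) [NormedAddCommGroup E] [NormedSpace ℝ E]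
    (c : C(ℝ, ℝ)) : L2 T E →L[ℝ] L2 T E :=
  LinearMap.mkContinuousOfExistsBound
    { toFun := fun x => (memLp_mul c.continuous x).toLp
      map_add' := fun x y => by
        rw [← MemLp.toLp_add]
        refine MemLp.toLp_congr _ _ ?_
        filter_upwards [Lp.coeFn_add x y] with t ht
        rw [ht, Pi.add_apply, smul_add, Pi.add_apply]
      map_smul' := fun r x => by
        rw [RingHom.id_apply, ← MemLp.toLp_const_smul]
        refine MemLp.toLp_congr _ _ ?_
        filter_upwards [Lp.coeFn_smul r x] with t ht
        simp [ht, smul_comm r] }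
    (by
      obtain ⟨K, hK⟩ := isCompact_Icc.exists_bound_of_continuousOn (s := Icc 0 T)
        c.continuous.continuousOn
      refine ⟨K, fun x => Lp.norm_le_mul_norm_of_ae_le_mul ?_⟩
      filter_upwards [(memLp_mul c.continuous x).coeFn_toLp, ae_restrict_mem measurableSet_Ioo]
        with t h ht
      simp only [LinearMap.coe_mk, AddHom.coe_mk]
      rw [h, norm_smul]
      gcongr
      exact hK t (Ioo_subset_Icc_self ht))

theorem coeFn_mulLp (c : C(ℝ, ℝ)) (x : L2 T E) :
    mulLp T E c x =ᵐ[timeMeasure T] fun t => c t • x t :=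
  (memLp_mul c.continuous x).coeFn_toLp

/-- The action of a constant operator on `L²`. -/
noncomputable abbrev constOp (T : ℝ) (M : E →L[ℝ] F) : L2 T E →L[ℝ] L2 T F :=
  M.compLpL 2 (timeMeasure T)

theorem coeFn_constOp (M : E →L[ℝ] F) (x : L2 T E) :
    constOp T M x =ᵐ[timeMeasure T] fun t => M (x t) := M.coeFn_compLpL x

theorem constOp_volterra [CompleteSpace E] [CompleteSpace F] (hT : 0 ≤ T) (M : E →L[ℝ] F)
    (x : L2 T E) :
    constOp T M (volterra hT E x) = volterra hT F (constOp T M x) := by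
  refine Lp.ext ?_
  filter_upwards [coeFn_constOp M (volterra hT E x), coeFn_volterra hT x,
    coeFn_volterra hT (constOp T M x)] with t h1 h2 h3
  rw [h1, h2, h3, ← ContinuousLinearMap.intervalIntegral_comp_comm M
    (integrable_coe x).intervalIntegrable]
  refine intervalIntegral.integral_congr_ae_restrict (ae_restrict_of_ae ?_)
  exact (coeFn_constOp M x).symm

theorem constOp_mulLp (M : E →L[ℝ] F) (c : C(ℝ, ℝ)) (x : L2 T E) :
    constOp T M (mulLp T E c x) = mulLp T F c (constOp T M x) := by
  refine Lp.ext ?_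
  filter_upwards [coeFn_constOp M (mulLp T E c x), coeFn_mulLp c x,
    coeFn_mulLp c (constOp T M x), coeFn_constOp M x] with t h1 h2 h3 h4
  rw [h1, h2, h3, h4, map_smul]

theorem mulLp_mulLp {c d : C(ℝ, ℝ)} (h : c * d = 1) (x : L2 T E) :
    mulLp T E c (mulLp T E d x) = x := by
  refine Lp.ext ?_
  filter_upwards [coeFn_mulLp c (mulLp T E d x), coeFn_mulLp d x] with t h1 h2
  have := DFunLike.congr_fun h t
  simp only [ContinuousMap.mul_apply, ContinuousMap.one_apply] at this
  rw [h1, h2, smul_smul, this, one_smul]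

theorem integral_timeMeasure_eq {t : ℝ} (ht0 : 0 ≤ t) (ht : t ≤ T) (x : ℝ → E) :
    ∫ s in (0 : ℝ)..t, x s ∂timeMeasure T = ∫ s in (0 : ℝ)..t, x s := by
  rw [intervalIntegral.integral_of_le ht0, intervalIntegral.integral_of_le ht0,
    integral_Ioc_eq_integral_Ioo, integral_Ioc_eq_integral_Ioo, timeMeasure,
    Measure.restrict_restrict measurableSet_Ioo, Ioo_inter_Ioo, max_self, min_eq_left ht]

/-- The primitive is continuous, so vanishing a.e. it vanishes throughout `(0,T)`; Lebesgue
differentiation then recovers `x = 0` a.e. -/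
theorem volterra_injective [CompleteSpace E] (hT : 0 ≤ T) {x : L2 T E}
    (h : volterra hT E x = 0) : x = 0 := by
  have hint : IntegrableOn x (Ioo 0 T) := integrable_coe x
  set f : ℝ → E := (Ioo 0 T).indicator x with hf
  have hfi : Integrable f := (integrable_indicator_iff measurableSet_Ioo).2 hint
  have hd := LocallyIntegrable.ae_hasDerivAt_integral hfi.locallyIntegrable
  have hcont : Continuous fun t => ∫ s in (0 : ℝ)..t, x s ∂timeMeasure T :=
    intervalIntegral.continuous_primitive (fun a b => (integrable_coe x).intervalIntegrable) 0
  have h0 : (fun t => ∫ s in (0 : ℝ)..t, x s ∂timeMeasure T) =ᵐ[timeMeasure T] fun _ => 0 := by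
    filter_upwards [coeFn_volterra hT x, Lp.coeFn_zero E 2 (timeMeasure T)] with t h1 h2
    rw [← h1, h, h2]; rfl
  have h1 : EqOn (fun t => ∫ s in (0 : ℝ)..t, x s ∂timeMeasure T) (fun _ => 0) (Ioo 0 T) :=
    Measure.eqOn_open_of_ae_eq h0 isOpen_Ioo hcont.continuousOn continuousOn_const
  have h2 : ∀ t ∈ Ioo 0 T, ∫ s in (0 : ℝ)..t, f s = 0 := by
    intro t ht
    have h3 : ∫ s in (0 : ℝ)..t, x s ∂timeMeasure T = 0 := h1 ht
    rw [← h3, integral_timeMeasure_eq ht.1.le ht.2.le]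
    rw [intervalIntegral.integral_of_le ht.1.le, intervalIntegral.integral_of_le ht.1.le]
    refine setIntegral_congr_fun measurableSet_Ioc fun s hs => ?_
    exact indicator_of_mem (show s ∈ Ioo 0 T from ⟨hs.1, hs.2.trans_lt ht.2⟩) _
  refine Lp.ext ?_
  filter_upwards [ae_restrict_of_ae hd, ae_restrict_mem measurableSet_Ioo,
    Lp.coeFn_zero E 2 (timeMeasure T)] with t h3 ht h4
  rw [h4]
  have h5 := h3 0
  have h6 : HasDerivAt (fun y => ∫ s in (0 : ℝ)..y, f s) 0 t := by
    refine (hasDerivAt_const t (0 : E)).congr_of_eventuallyEq ?_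
    filter_upwards [isOpen_Ioo.mem_nhds ht] with y hy using h2 y hy
  have := h5.unique h6
  rwa [hf, indicator_of_mem ht] at this

/-- The integral over `(0,T)` as a continuous linear map on `L²(0,T;E)`. -/
noncomputable def integralLp (T : ℝ) (E : Type*) [NormedAddCommGroup E] [NormedSpace ℝ E] :
    L2 T E →L[ℝ] E :=
  LinearMap.mkContinuousOfExistsBound
    { toFun := fun x => ∫ t, x t ∂timeMeasure T
      map_add' := fun x y => by
        rw [← integral_add (integrable_coe x) (integrable_coe y)]
        exact integral_congr_ae (Lp.coeFn_add x y)
      map_smul' := fun r x => by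
        rw [RingHom.id_apply, ← integral_smul]
        exact integral_congr_ae (Lp.coeFn_smul r x) }
    ((exists_integral_norm_le T E).imp fun _ hK x =>
      (norm_integral_le_integral_norm _).trans (hK x))

theorem integralLp_mulLp (c : C(ℝ, ℝ)) (x : L2 T E) :
    integralLp T E (mulLp T E c x) = ∫ t in Ioo 0 T, c t • x t :=
  integral_congr_ae (coeFn_mulLp c x)

theorem continuous_integral_mul (c : C(ℝ, ℝ)) :
    Continuous fun x : L2 T E => ∫ t in Ioo 0 T, c t • x t :=
  ((integralLp T E).continuous.comp (mulLp T E c).continuous).congr (integralLp_mulLp c)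

theorem HasWeakTimeDeriv.sub {x z x' z' : L2 T E} (h : HasWeakTimeDeriv T x z)
    (h' : HasWeakTimeDeriv T x' z') :
    HasWeakTimeDeriv T (x - x' : L2 T E) (z - z' : L2 T E) := by
  intro φ hφ hc hs
  have hφ' : Continuous (deriv φ) := hφ.continuous_deriv (by simp)
  have h1 := h φ hφ hc hs
  have h2 := h' φ hφ hc hs
  have e : ∀ (c : ℝ → ℝ) (hc : Continuous c) (y : L2 T E),
      ∫ t in Ioo 0 T, c t • y t = integralLp T E (mulLp T E ⟨c, hc⟩ y) :=
    fun c hc y => (integralLp_mulLp ⟨c, hc⟩ y).symm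
  simp only [e _ hφ', e _ hφ.continuous, map_sub] at h1 h2 ⊢
  rw [h1, h2]
  abel

theorem HasWeakTimeDeriv.constOp [CompleteSpace E] [CompleteSpace F] (M : E →L[ℝ] F)
    {x z : L2 T E} (h : HasWeakTimeDeriv T x z) :
    HasWeakTimeDeriv T (RiskAverse.constOp T M x) (RiskAverse.constOp T M z) := by
  intro φ hφ hc hs
  have e : ∀ (c : ℝ → ℝ) (_ : Continuous c) (y : L2 T E),
      ∫ t in Ioo 0 T, c t • RiskAverse.constOp T M y t = M (∫ t in Ioo 0 T, c t • y t) := by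
    intro c hc y
    rw [← M.integral_comp_comm ((memLp_mul hc y).integrable one_le_two)]
    refine integral_congr_ae ?_
    filter_upwards [coeFn_constOp M y] with t ht
    rw [ht, map_smul]
  rw [e _ (hφ.continuous_deriv (by simp)), e _ hφ.continuous, h φ hφ hc hs, map_neg]

theorem HasWeakTimeDeriv.congr {w z w' z' : ℝ → E}
    (h : HasWeakTimeDeriv T w z) (hw : w =ᵐ[timeMeasure T] w') (hz : z =ᵐ[timeMeasure T] z') :
    HasWeakTimeDeriv T w' z' := by
  intro φ hφ hc hs
  have e : ∀ (c : ℝ → ℝ) (y y' : ℝ → E), y =ᵐ[timeMeasure T] y' →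
      ∫ t in Ioo 0 T, c t • y t = ∫ t in Ioo 0 T, c t • y' t := fun c y y' hy =>
    integral_congr_ae (hy.mono fun t ht => by simp only [ht])
  rw [← e _ _ _ hw, ← e _ _ _ hz, h φ hφ hc hs]

end Operators

/-! ### Weak derivatives of primitives and the lemma of du Bois-Reymond. -/

section Primitive

variable {E : Type*} [NormedAddCommGroup E] [NormedSpace ℝ E] [CompleteSpace E] {T : ℝ}

omit [CompleteSpace E] in
theorem primC_bcfLp (x : ℝ →ᵇ E) (t : Set.Icc (0 : ℝ) T) :
    primC T E (bcfLp T E x) t = ∫ s in (0 : ℝ)..t, x s := by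
  rw [primC_apply, ← integral_timeMeasure_eq t.2.1 t.2.2]
  exact intervalIntegral.integral_congr_ae_restrict (ae_restrict_of_ae (coeFn_bcfLp x))

omit [CompleteSpace E] in
theorem coeFn_volterra_bcfLp (hT : 0 ≤ T) (x : ℝ →ᵇ E) :
    volterra hT E (bcfLp T E x) =ᵐ[timeMeasure T] fun t => ∫ s in (0 : ℝ)..t, x s := by
  filter_upwards [coeFn_contLp hT (primC T E (bcfLp T E x)), ae_restrict_mem measurableSet_Ioo]
    with t ht hmem
  rw [volterra, ContinuousLinearMap.comp_apply, ht,
    Set.IccExtend_of_mem _ _ (Ioo_subset_Icc_self hmem), primC_bcfLp]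

theorem hasDerivAt_primitive (x : ℝ →ᵇ E) (t : ℝ) :
    HasDerivAt (fun t => ∫ s in (0 : ℝ)..t, x s) (x t) t :=
  intervalIntegral.integral_hasDerivAt_right (x.continuous.intervalIntegrable _ _)
    (x.continuous.stronglyMeasurableAtFilter _ _) x.continuous.continuousAt

theorem setIntegral_Ioo_eq {G : Type*} [NormedAddCommGroup G] [NormedSpace ℝ G] (hT : 0 ≤ T)
    (f : ℝ → G) : ∫ t in Ioo 0 T, f t = ∫ t in (0 : ℝ)..T, f t := by
  rw [intervalIntegral.integral_of_le hT, integral_Ioc_eq_integral_Ioo]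

theorem eq_zero_of_tsupport_subset {φ : ℝ → ℝ} (h : tsupport φ ⊆ Ioo 0 T) :
    φ 0 = 0 ∧ φ T = 0 :=
  ⟨image_eq_zero_of_notMem_tsupport fun h0 => lt_irrefl _ (h h0).1,
    image_eq_zero_of_notMem_tsupport fun h0 => lt_irrefl _ (h h0).2⟩

/-- Both sides of the defining identity are continuous in `x`, so bounded continuous `x` suffice.
For these it is classical integration by parts, with boundary terms killed by `φ`. -/
theorem hasWeakTimeDeriv_volterra (hT : 0 ≤ T) (x : L2 T E) :
    HasWeakTimeDeriv T (volterra hT E x) x := by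
  intro φ hφ _ hsupp
  have hφ' : Continuous (deriv φ) := hφ.continuous_deriv (by simp)
  have hclosed : IsClosed {x : L2 T E | ∫ t in Ioo 0 T, deriv φ t • volterra hT E x t =
      -∫ t in Ioo 0 T, φ t • x t} :=
    isClosed_eq ((continuous_integral_mul ⟨deriv φ, hφ'⟩).comp (volterra hT E).continuous)
      (continuous_integral_mul ⟨φ, hφ.continuous⟩).neg
  refine (bcfLp_denseRange T E).induction_on x hclosed fun z => ?_
  have e1 : ∫ t in Ioo 0 T, deriv φ t • volterra hT E (bcfLp T E z) t =
      ∫ t in (0 : ℝ)..T, deriv φ t • ∫ s in (0 : ℝ)..t, z s := by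
    rw [← setIntegral_Ioo_eq hT]
    refine integral_congr_ae ?_
    filter_upwards [coeFn_volterra_bcfLp hT z] with t ht
    rw [ht]
  have e2 : ∫ t in Ioo 0 T, φ t • bcfLp T E z t = ∫ t in (0 : ℝ)..T, φ t • z t := by
    rw [← setIntegral_Ioo_eq hT]
    refine integral_congr_ae ?_
    filter_upwards [coeFn_bcfLp z] with t ht
    rw [ht]
  rw [e1, e2]
  have hp : Continuous fun t => ∫ s in (0 : ℝ)..t, z s :=
    continuous_iff_continuousAt.2 fun t => (hasDerivAt_primitive z t).continuousAt
  have h := intervalIntegral.integral_eq_sub_of_hasDerivAt (a := 0) (b := T)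
    (fun t _ => ((hφ.differentiable (by simp)).differentiableAt.hasDerivAt (x := t)).smul
      (hasDerivAt_primitive z t))
    (((hφ.continuous.smul z.continuous).add (hφ'.smul hp)).intervalIntegrable _ _)
  obtain ⟨h0, h1⟩ := eq_zero_of_tsupport_subset hsupp
  simp only [Pi.smul_apply', h0, h1, zero_smul, sub_zero] at h
  have h2 := intervalIntegral.integral_add (μ := volume) (a := 0) (b := T)
    (f := fun t => φ t • z t) (g := fun t => deriv φ t • ∫ s in (0 : ℝ)..t, z s)
    ((hφ.continuous.smul z.continuous).intervalIntegrable _ _)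
    ((hφ'.smul hp).intervalIntegrable _ _)
  exact eq_neg_of_add_eq_zero_right (h2.symm.trans h)

omit [CompleteSpace E] in
theorem integral_Ioo_eq_of_tsupport_subset {φ : ℝ → ℝ} (hφ : tsupport φ ⊆ Ioo 0 T) (f : ℝ → E) :
    ∫ t in Ioo 0 T, φ t • f t = ∫ t, φ t • f t :=
  setIntegral_eq_integral_of_forall_compl_eq_zero fun t ht => by
    rw [image_eq_zero_of_notMem_tsupport fun h => ht (hφ h), zero_smul]

/-- A test function with vanishing integral is the derivative of a test function. -/
theorem exists_primitive_of_integral_eq_zero {ψ : ℝ → ℝ} (hψ : ContDiff ℝ ∞ ψ)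
    (hc : HasCompactSupport ψ) (hs : tsupport ψ ⊆ Ioo 0 T) (h0 : ∫ t, ψ t = 0) :
    ∃ φ : ℝ → ℝ, ContDiff ℝ ∞ φ ∧ HasCompactSupport φ ∧ tsupport φ ⊆ Ioo 0 T ∧
      deriv φ = ψ := by
  obtain ⟨a, b, hab⟩ : ∃ a b, tsupport ψ ⊆ Icc a b ∧ 0 < a ∧ b < T := by
    rcases (tsupport ψ).eq_empty_or_nonempty with h | h
    -- For empty support only `0 < a` and `b < T` matter; the interval may itself be empty.
    · exact ⟨1, T - 1, by simp [h], by norm_num, by linarith⟩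
    · obtain ⟨a, ha, ha'⟩ := hc.isCompact.exists_isLeast h
      obtain ⟨b, hb, hb'⟩ := hc.isCompact.exists_isGreatest h
      exact ⟨a, b, fun t ht => ⟨ha' ht, hb' ht⟩, (hs ha).1, (hs hb).2⟩
  obtain ⟨hab, ha, hb⟩ := hab
  have hzero : ∀ t, t ∉ Icc a b → ψ t = 0 := fun t ht =>
    image_eq_zero_of_notMem_tsupport fun h => ht (hab h)
  have hd : ∀ t, HasDerivAt (fun t => ∫ s in a..t, ψ s) (ψ t) t := fun t =>
    intervalIntegral.integral_hasDerivAt_right (hψ.continuous.intervalIntegrable _ _)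
      (hψ.continuous.stronglyMeasurableAtFilter _ _) hψ.continuous.continuousAt
  have hderiv : deriv (fun t => ∫ s in a..t, ψ s) = ψ := funext fun t => (hd t).deriv
  have hsub : Function.support (fun t => ∫ s in a..t, ψ s) ⊆ Icc a b := by
    intro t ht
    by_contra hmem
    apply ht
    rcases lt_or_ge t a with h | h
    · refine intervalIntegral.integral_zero_ae (Filter.Eventually.of_forall fun s hs' => ?_)
      rw [uIoc_of_ge h.le] at hs'
      rcases eq_or_lt_of_le hs'.2 with h2 | h2
      -- The endpoint `s = a` belongs to the interval of integration; `ψ a = 0` follows by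
      -- continuity from the left.
      · by_contra hne
        have : a ∈ closure (Iio a) := by rw [closure_Iio]; exact self_mem_Iic
        have h3 : EqOn ψ (fun _ => 0) (closure (Iio a)) :=
          EqOn.closure (fun r hr => hzero r fun h => not_le.2 hr h.1) hψ.continuous
            continuous_const
        exact hne (by rw [h2]; exact h3 this)
      · exact hzero s fun h => not_le.2 h2 h.1
    · have hbt : b < t := by
        by_contra hle
        exact hmem ⟨h, not_lt.1 hle⟩
      change ∫ s in a..t, ψ s = 0
      rw [intervalIntegral.integral_of_le h, ← h0, ← integral_Icc_eq_integral_Ioc]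
      exact setIntegral_eq_integral_of_forall_compl_eq_zero fun s hs' =>
        hzero s fun h => hs' ⟨h.1, h.2.trans hbt.le⟩
  have hts : tsupport (fun t => ∫ s in a..t, ψ s) ⊆ Icc a b :=
    closure_minimal hsub isClosed_Icc
  refine ⟨fun t => ∫ s in a..t, ψ s, ?_, ?_, ?_, hderiv⟩
  · rw [contDiff_infty_iff_deriv, hderiv]
    exact ⟨fun t => (hd t).differentiableAt, hψ⟩
  · exact HasCompactSupport.of_support_subset_isCompact isCompact_Icc hsub
  · exact hts.trans fun t ht => ⟨ha.trans_le ht.1, ht.2.trans_lt hb⟩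

/-- The lemma of du Bois-Reymond. -/
theorem exists_ae_eq_const_of_weakDeriv_zero (hT : 0 < T) {k : ℝ → E}
    (hk : IntegrableOn k (Ioo 0 T)) (h : HasWeakTimeDeriv T k 0) :
    ∃ c : E, k =ᵐ[timeMeasure T] fun _ => c := by
  -- A bump supported in `[T/4, 3T/4]`; normalized to integral 1 it picks out the constant as `c = ∫
  -- η k`.
  let η : ContDiffBump (T / 2) := ⟨T / 8, T / 4, by positivity, by linarith⟩
  have hη : ContDiff ℝ ∞ (η.normed volume) := η.contDiff_normed
  have hηc : HasCompactSupport (η.normed volume) := η.hasCompactSupport_normed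
  have hηs : tsupport (η.normed volume) ⊆ Ioo 0 T := by
    rw [η.tsupport_normed_eq, Real.closedBall_eq_Icc]
    intro t ht
    simp only [η] at ht
    exact ⟨by linarith [ht.1], by linarith [ht.2]⟩
  have hη1 : ∫ t, η.normed volume t = 1 := η.integral_normed
  have hint : ∀ c : ℝ → ℝ, Continuous c → HasCompactSupport c →
      IntegrableOn (fun t => c t • k t) (Ioo 0 T) := fun c hc hcs => by
    obtain ⟨K, hK⟩ := hcs.exists_bound_of_continuous hc
    exact hk.bdd_smul K hc.aestronglyMeasurable (Filter.Eventually.of_forall hK)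
  set c : E := ∫ t in Ioo 0 T, η.normed volume t • k t with hcdef
  refine ⟨c, ?_⟩
  have hkey := isOpen_Ioo.ae_eq_zero_of_integral_contDiff_smul_eq_zero (μ := volume)
    (f := fun t => k t - c) (U := Ioo 0 T)
    ((hk.sub (integrable_const c)).locallyIntegrableOn) ?_
  · rw [Filter.EventuallyEq, ae_restrict_iff' measurableSet_Ioo]
    filter_upwards [hkey] with t ht hmem
    exact sub_eq_zero.1 (ht hmem)
  intro ψ hψ hψc hψs
  set r : ℝ := ∫ t, ψ t with hr
  have hψi : Integrable ψ := hψ.continuous.integrable_of_hasCompactSupport hψc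
  have hηi : Integrable (η.normed volume) := η.integrable_normed
  -- Subtracting `(∫ ψ) η` gives `ψ` mean zero, so the difference is a derivative `φ'` and
  -- integrates to zero against `k`.
  obtain ⟨φ, hφ, hφc, hφs, hφd⟩ := exists_primitive_of_integral_eq_zero (T := T)
    (ψ := fun t => ψ t - r * η.normed volume t)
    (hψ.sub (contDiff_const.mul hη)) (hψc.sub hηc.mul_left)
    ((tsupport_sub _ _).trans (union_subset hψs ((tsupport_mul_subset_right).trans hηs)))
    (by rw [integral_sub hψi (hηi.const_mul r), integral_const_mul, hη1, mul_one, sub_self])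
  have h1 := h φ hφ hφc hφs
  rw [hφd] at h1
  simp only [Pi.zero_apply, smul_zero, integral_zero, neg_zero, sub_smul, mul_smul] at h1
  have h4 : IntegrableOn (fun t => r • η.normed volume t • k t) (Ioo 0 T) :=
    (hint _ hη.continuous hηc).smul r
  rw [integral_sub (hint ψ hψ.continuous hψc) h4, integral_smul, ← hcdef] at h1
  simp only [smul_sub]
  have h2 := integral_Ioo_eq_of_tsupport_subset hψs fun t => k t - c
  have h3 := integral_Ioo_eq_of_tsupport_subset hψs fun _ => c
  simp only [smul_sub] at h2
  rw [integral_smul_const (μ := volume) (f := ψ)] at h3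
  rw [← h2, integral_sub (hint ψ hψ.continuous hψc) (hψi.integrableOn.smul_const c), h3]
  exact h1

end Primitive

/-! ### Density and uniqueness from accretivity in abstract Hilbert spaces. -/

section Abstract

variable {X Y : Type*} [NormedAddCommGroup X] [InnerProductSpace ℝ X] [CompleteSpace X]
  [NormedAddCommGroup Y] [InnerProductSpace ℝ Y] [CompleteSpace Y]

/-- Expanding the square shows that the condition is equivalent to `‖L - r‖ ≤ r` with `r = 1 / (2
ρ)`, and the operator norm is invariant under adjoints. -/
theorem accretive_adjoint {L : X →L[ℝ] X} {ρ : ℝ} (hρ : 0 < ρ)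
    (h : ∀ x, ρ * ‖L x‖ ^ 2 ≤ ⟪x, L x⟫) (x : X) : ρ * ‖(L†) x‖ ^ 2 ≤ ⟪x, (L†) x⟫ := by
  set r : ℝ := 1 / (2 * ρ) with hr
  have hr0 : 0 < r := by positivity
  have hrρ : 2 * ρ * r = 1 := by rw [hr]; field_simp
  have hexp : ∀ y x : X, ‖y - r • x‖ ^ 2 = ‖y‖ ^ 2 - 2 * r * ⟪x, y⟫ + r ^ 2 * ‖x‖ ^ 2 := by
    intro y x
    rw [norm_sub_sq_real, inner_smul_right, norm_smul, Real.norm_of_nonneg hr0.le,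
      real_inner_comm]
    ring
  set N : X →L[ℝ] X := L - r • ContinuousLinearMap.id ℝ X with hN
  have hbound : ‖N‖ ≤ r := by
    refine N.opNorm_le_bound hr0.le fun y => ?_
    refine abs_le_of_sq_le_sq' ?_ (by positivity) |>.2
    have : N y = L y - r • y := by simp [hN]
    rw [this, hexp, mul_pow]
    have h2 := mul_le_mul_of_nonneg_left (h y) (by positivity : 0 ≤ 2 * r)
    have h3 : 2 * r * (ρ * ‖L y‖ ^ 2) = ‖L y‖ ^ 2 := by
      rw [← mul_assoc, show 2 * r * ρ = 1 by linarith, one_mul]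
    linarith
  have hadj : (N†) x = (L†) x - r • x := by
    refine ext_inner_left ℝ fun y => ?_
    rw [ContinuousLinearMap.adjoint_inner_right, inner_sub_right,
      ContinuousLinearMap.adjoint_inner_right, inner_smul_right]
    simp [hN, inner_sub_left, inner_smul_left]
  have h4 : ‖(L†) x - r • x‖ ≤ r * ‖x‖ := by
    rw [← hadj]
    refine ((N†).le_opNorm x).trans ?_
    rw [LinearIsometryEquiv.norm_map]
    gcongr
  have h5 := pow_le_pow_left₀ (norm_nonneg _) h4 2
  rw [hexp, mul_pow] at h5
  have h6 : ρ * (2 * r * ⟪x, (L†) x⟫) = ⟪x, (L†) x⟫ := by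
    rw [← mul_assoc, show ρ * (2 * r) = 1 by linarith, one_mul]
  nlinarith [h5, hρ]

/-- In the application `Λ` is the embedding, `Λ'` its adjoint, and `L`, `M` are the damped Volterra
operators on the two spaces. A vector orthogonal to the range is shown to vanish. -/
theorem denseRange_of_accretive {Λ : X →L[ℝ] Y} {Λ' : Y →L[ℝ] X} {a L : X →L[ℝ] X}
    {M : Y →L[ℝ] Y} {ρ α : ℝ} (hρ : 0 < ρ) (hα : 0 < α)
    (hΛ : ∀ x y, ⟪Λ x, y⟫ = ⟪x, Λ' y⟫)
    (hL : ∀ x, ρ * ‖L x‖ ^ 2 ≤ ⟪x, L x⟫) (hM : ∀ y, ρ * ‖M y‖ ^ 2 ≤ ⟪y, M y⟫)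
    (hinj : ∀ x, L x = 0 → x = 0) (hcomm : ∀ y, Λ' (M y) = L (Λ' y))
    (hcomm' : ∀ x, a (L x) = L (a x))
    (hcoer : ∀ x, α * ‖x‖ ^ 2 ≤ -⟪a x, x⟫ + ρ * ‖Λ x‖ ^ 2) :
    DenseRange (Λ'.comp Λ - a.comp L) := by
  have hΛL : ∀ x, Λ ((L†) x) = (M†) (Λ x) := fun x => ext_inner_right ℝ fun y => by
    rw [hΛ, ContinuousLinearMap.adjoint_inner_left, ContinuousLinearMap.adjoint_inner_left, hΛ,
      hcomm]
  have hdense := (Submodule.dense_iff_topologicalClosure_eq_top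
    (s := LinearMap.range (Λ'.comp Λ - a.comp L).toLinearMap)).2 ?_
  · exact hdense
  rw [Submodule.topologicalClosure_eq_top_iff, Submodule.eq_bot_iff]
  intro w hw
  rw [Submodule.mem_orthogonal] at hw
  have hw' : ∀ x, ⟪Λ x, Λ w⟫ = ⟪a (L x), w⟫ := fun x => by
    have := hw _ ⟨x, rfl⟩
    simp only [ContinuousLinearMap.coe_coe, sub_apply,
      ContinuousLinearMap.comp_apply, inner_sub_left] at this
    rw [real_inner_comm, ← hΛ, real_inner_comm] at this
    linarith
  -- With `x = L† w` the right side becomes `⟪a L† w, L† w⟫`, since `a` commutes with `L`. The left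
  -- side is at least `ρ ‖Λ L† w‖²` by accretivity of `M†`. Coercivity then forces `L† w = 0`.
  have h1 := hw' ((L†) w)
  rw [hΛL, hcomm', ← ContinuousLinearMap.adjoint_inner_right L, real_inner_comm] at h1
  have h2 := accretive_adjoint hρ hM (Λ w)
  have h3 := hcoer ((L†) w)
  rw [hΛL] at h3
  have h4 : ‖(L†) w‖ ^ 2 ≤ 0 := by
    nlinarith
  have h5 : (L†) w = 0 := norm_eq_zero.1 (pow_eq_zero_iff two_ne_zero |>.1
    (le_antisymm h4 (sq_nonneg _)))
  -- From `⟪w, L w⟫ = ⟪L† w, w⟫ = 0`, accretivity gives `L w = 0`.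
  have h6 := hL w
  rw [← ContinuousLinearMap.adjoint_inner_left, h5, inner_zero_left] at h6
  refine hinj w (norm_eq_zero.1 (pow_eq_zero_iff two_ne_zero |>.1 (le_antisymm ?_ (sq_nonneg _))))
  nlinarith

-- Pairing the equation with `L v` gives `⟪M Λ v, Λ v⟫ = ⟪a L v, L v⟫`; accretivity of `M` and
-- coercivity at `L v` then force `L v = 0`.
omit [CompleteSpace X] [CompleteSpace Y] in
theorem eq_zero_of_accretive {Λ : X →L[ℝ] Y} {Λ' : Y →L[ℝ] X} {a L : X →L[ℝ] X}
    {M : Y →L[ℝ] Y} {ρ α : ℝ} (hα : 0 < α)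
    (hΛ : ∀ x y, ⟪Λ x, y⟫ = ⟪x, Λ' y⟫) (hM : ∀ y, ρ * ‖M y‖ ^ 2 ≤ ⟪y, M y⟫)
    (hinj : ∀ x, L x = 0 → x = 0) (hcomm : ∀ x, Λ (L x) = M (Λ x))
    (hcomm' : ∀ x, a (L x) = L (a x))
    (hcoer : ∀ x, α * ‖x‖ ^ 2 ≤ -⟪a x, x⟫ + ρ * ‖Λ x‖ ^ 2)
    {v : X} (hv : Λ' (Λ v) = L (a v)) : v = 0 := by
  have h1 : ⟪L v, Λ' (Λ v)⟫ = ⟪L v, a (L v)⟫ := by rw [hv, hcomm']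
  rw [← hΛ, hcomm, real_inner_comm, real_inner_comm (a (L v))] at h1
  have h2 := hM (Λ v)
  have h3 := hcoer (L v)
  rw [hcomm] at h3
  refine hinj v (norm_eq_zero.1 (pow_eq_zero_iff two_ne_zero |>.1 (le_antisymm ?_ (sq_nonneg _))))
  nlinarith

end Abstract

/-! ### The damped Volterra operator and the integrated parabolic equation. -/

section Hilbert

variable {E F : Type*} [NormedAddCommGroup E] [InnerProductSpace ℝ E] [CompleteSpace E]
  [NormedAddCommGroup F] [InnerProductSpace ℝ F] [CompleteSpace F] {T : ℝ}

/-- The weight `t ↦ exp (ρ t)`. -/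
noncomputable def weight (ρ : ℝ) : C(ℝ, ℝ) := ⟨fun t => Real.exp (ρ * t), by fun_prop⟩

theorem weight_apply (ρ t : ℝ) : weight ρ t = Real.exp (ρ * t) := rfl

theorem weight_mul_weight_neg (ρ : ℝ) : weight ρ * weight (-ρ) = 1 := by
  ext t
  simp [weight_apply, ← Real.exp_add]

theorem weight_neg_mul_weight (ρ : ℝ) : weight (-ρ) * weight ρ = 1 := by
  rw [mul_comm, weight_mul_weight_neg]

omit [CompleteSpace E] in
theorem inner_eq_intervalIntegral (hT : 0 ≤ T) {x y : L2 T E} {f g : ℝ → E}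
    (hx : x =ᵐ[timeMeasure T] f) (hy : y =ᵐ[timeMeasure T] g) :
    ⟪x, y⟫ = ∫ t in (0 : ℝ)..T, ⟪f t, g t⟫ := by
  rw [← setIntegral_Ioo_eq hT, L2.inner_def]
  refine integral_congr_ae ?_
  filter_upwards [hx, hy] with t h1 h2
  rw [h1, h2]

/-- The Volterra operator with kernel `exp (-ρ (t - s))`. -/
noncomputable def dampedVolterra (hT : 0 ≤ T) (ρ : ℝ) (E : Type*) [NormedAddCommGroup E]
    [NormedSpace ℝ E] : L2 T E →L[ℝ] L2 T E :=
  (mulLp T E (weight (-ρ))).comp ((volterra hT E).comp (mulLp T E (weight ρ)))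

/-- The image `q` of `y` solves `q' = y - ρ q`, `q 0 = 0`, so `⟪y, q⟫ - ρ ‖q‖²` is the integral of
`½ (‖q‖²)'`, which is `½ ‖q T‖² ≥ 0`. -/
theorem accretive_dampedVolterra (hT : 0 ≤ T) (ρ : ℝ) (y : L2 T E) :
    ρ * ‖dampedVolterra hT ρ E y‖ ^ 2 ≤ ⟪y, dampedVolterra hT ρ E y⟫ := by
  -- Substituting `z = exp (ρ t) y` leaves only the undamped primitive; by density `z` may be taken
  -- bounded and continuous.
  suffices h : ∀ z : L2 T E, ρ * ‖mulLp T E (weight (-ρ)) (volterra hT E z)‖ ^ 2 ≤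
      ⟪mulLp T E (weight (-ρ)) z, mulLp T E (weight (-ρ)) (volterra hT E z)⟫ by
    have := h (mulLp T E (weight ρ) y)
    rwa [mulLp_mulLp (weight_neg_mul_weight ρ)] at this
  intro z
  refine (bcfLp_denseRange T E).induction_on z (isClosed_le (by fun_prop) (by fun_prop)) fun x => ?_
  set q : ℝ → E := fun t => Real.exp (-ρ * t) • ∫ s in (0 : ℝ)..t, x s with hq
  have hd : ∀ t, HasDerivAt q (Real.exp (-ρ * t) • x t - ρ • q t) t := fun t => by
    have h1 : HasDerivAt (fun t => Real.exp (-ρ * t)) (Real.exp (-ρ * t) * -ρ) t := by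
      simpa using ((hasDerivAt_id t).const_mul (-ρ)).exp
    refine (h1.smul (hasDerivAt_primitive x t)).congr_deriv ?_
    rw [sub_eq_add_neg, ← neg_smul, hq, smul_smul, mul_comm _ (-ρ)]
  have hqc : Continuous q := continuous_iff_continuousAt.2 fun t => (hd t).continuousAt
  have e1 : mulLp T E (weight (-ρ)) (bcfLp T E x) =ᵐ[timeMeasure T]
      fun t => Real.exp (-ρ * t) • x t := by
    filter_upwards [coeFn_mulLp (weight (-ρ)) (bcfLp T E x), coeFn_bcfLp (T := T) x] with t h1 h2
    rw [h1, h2, weight_apply]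
  have e2 : mulLp T E (weight (-ρ)) (volterra hT E (bcfLp T E x)) =ᵐ[timeMeasure T] q := by
    filter_upwards [coeFn_mulLp (weight (-ρ)) (volterra hT E (bcfLp T E x)),
      coeFn_volterra_bcfLp hT x] with t h1 h2
    rw [h1, h2, weight_apply]
  have hd2 : ∀ t, HasDerivAt (fun t => ‖q t‖ ^ 2)
      (2 * (⟪Real.exp (-ρ * t) • x t, q t⟫ - ρ * ⟪q t, q t⟫)) t := fun t => by
    convert (hd t).norm_sq using 1
    rw [inner_sub_right, inner_smul_right _ (q t), real_inner_comm]
  have hxc : Continuous fun t => ⟪Real.exp (-ρ * t) • x t, q t⟫ := by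
    have := x.continuous
    fun_prop
  have hqq : Continuous fun t => ⟪q t, q t⟫ := by fun_prop
  have h3 := intervalIntegral.integral_eq_sub_of_hasDerivAt (a := 0) (b := T) (fun t _ => hd2 t)
    ((continuous_const.mul (hxc.sub (continuous_const.mul hqq))).intervalIntegrable _ _)
  have h5 : Continuous fun t => ρ * ⟪q t, q t⟫ := continuous_const.mul hqq
  rw [intervalIntegral.integral_const_mul, intervalIntegral.integral_sub
    (hxc.intervalIntegrable _ _) (h5.intervalIntegrable _ _),
    intervalIntegral.integral_const_mul, ← inner_eq_intervalIntegral hT e1 e2,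
    ← inner_eq_intervalIntegral hT e2 e2, real_inner_self_eq_norm_sq] at h3
  have h4 : q 0 = 0 := by simp [hq]
  rw [h4, norm_zero] at h3
  nlinarith [sq_nonneg ‖q T‖]

theorem dampedVolterra_injective (hT : 0 ≤ T) (ρ : ℝ) {x : L2 T E}
    (h : dampedVolterra hT ρ E x = 0) : x = 0 := by
  have h1 : volterra hT E (mulLp T E (weight ρ) x) = 0 := by
    rw [← mulLp_mulLp (weight_mul_weight_neg ρ) (volterra hT E (mulLp T E (weight ρ) x))]
    rw [dampedVolterra, ContinuousLinearMap.comp_apply, ContinuousLinearMap.comp_apply] at h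
    rw [h, map_zero]
  have h2 := volterra_injective hT h1
  rw [← mulLp_mulLp (weight_neg_mul_weight ρ) x, h2, map_zero]

theorem constOp_dampedVolterra (hT : 0 ≤ T) (ρ : ℝ) (M : E →L[ℝ] F) (x : L2 T E) :
    constOp T M (dampedVolterra hT ρ E x) = dampedVolterra hT ρ F (constOp T M x) := by
  simp only [dampedVolterra, ContinuousLinearMap.comp_apply, constOp_mulLp, constOp_volterra]

theorem inner_constOp (M : E →L[ℝ] F) (x : L2 T E) (y : L2 T F) :
    ⟪constOp T M x, y⟫ = ⟪x, constOp T (M†) y⟫ := by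
  rw [L2.inner_def, L2.inner_def]
  refine integral_congr_ae ?_
  filter_upwards [coeFn_constOp M x, coeFn_constOp (M†) y] with t h1 h2
  rw [h1, h2, ContinuousLinearMap.adjoint_inner_right]

omit [CompleteSpace E] [CompleteSpace F] in
theorem constOp_coercive {ι : E →L[ℝ] F} {a : E →L[ℝ] E} {α ρ : ℝ}
    (h : ∀ v, α * ‖v‖ ^ 2 ≤ -⟪a v, v⟫ + ρ * ‖ι v‖ ^ 2) (x : L2 T E) :
    α * ‖x‖ ^ 2 ≤ -⟪constOp T a x, x⟫ + ρ * ‖constOp T ι x‖ ^ 2 := by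
  rw [← real_inner_self_eq_norm_sq x, ← real_inner_self_eq_norm_sq (constOp T ι x),
    L2.inner_def, L2.inner_def, L2.inner_def, ← integral_const_mul, ← integral_const_mul,
    ← integral_neg]
  have h1 : Integrable (fun t => -⟪constOp T a x t, x t⟫) (timeMeasure T) :=
    (L2.integrable_inner (𝕜 := ℝ) _ _).neg
  have h2 : Integrable (fun t => ρ * ⟪constOp T ι x t, constOp T ι x t⟫) (timeMeasure T) :=
    (L2.integrable_inner (𝕜 := ℝ) _ _).const_mul _
  rw [← integral_add h1 h2]
  refine integral_mono_ae ((L2.integrable_inner _ _).const_mul _) (h1.add h2) ?_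
  filter_upwards [coeFn_constOp a x, coeFn_constOp ι x] with t h1 h2
  simp only [h1, h2, real_inner_self_eq_norm_sq]
  exact h (x t)

/-- A parabolic operator in integrated form has dense range. -/
theorem denseRange_parabolic (hT : 0 ≤ T) {ι : E →L[ℝ] F} {a : E →L[ℝ] E} {α ρ : ℝ} (hα : 0 < α)
    (hρ : 0 < ρ) (h : ∀ v, α * ‖v‖ ^ 2 ≤ -⟪a v, v⟫ + ρ * ‖ι v‖ ^ 2) :
    DenseRange fun x : L2 T E => constOp T (ι†) (constOp T ι x) -
      constOp T a (volterra hT E x) := by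
  have hd := denseRange_of_accretive (Λ := constOp T ι) (Λ' := constOp T (ι†)) (a := constOp T a)
    hρ hα (inner_constOp ι) (accretive_dampedVolterra hT ρ) (accretive_dampedVolterra hT ρ)
    (fun x => dampedVolterra_injective hT ρ)
    (constOp_dampedVolterra hT ρ _) (constOp_dampedVolterra hT ρ a) (constOp_coercive h)
  -- Multiplication by `exp (ρ t)` is invertible and commutes with operators constant in time, so it
  -- conjugates the damped operator into the undamped one.
  have hsurj : Function.Surjective (mulLp T E (weight ρ)) := fun y =>
    ⟨mulLp T E (weight (-ρ)) y, mulLp_mulLp (weight_mul_weight_neg ρ) y⟩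
  refine ((hsurj.denseRange.comp hd (mulLp T E (weight ρ)).continuous).mono ?_)
  rintro _ ⟨x, rfl⟩
  refine ⟨mulLp T E (weight ρ) x, ?_⟩
  simp only [Function.comp_apply, sub_apply, ContinuousLinearMap.comp_apply,
    dampedVolterra, map_sub, constOp_mulLp, mulLp_mulLp (weight_mul_weight_neg ρ)]

theorem eq_zero_of_parabolic (hT : 0 ≤ T) {ι : E →L[ℝ] F} {a : E →L[ℝ] E} {α ρ : ℝ} (hα : 0 < α)
    (h : ∀ v, α * ‖v‖ ^ 2 ≤ -⟪a v, v⟫ + ρ * ‖ι v‖ ^ 2) {v : L2 T E}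
    (hv : constOp T (ι†) (constOp T ι v) = volterra hT E (constOp T a v)) : v = 0 := by
  have h0 := eq_zero_of_accretive (Λ := constOp T ι) (Λ' := constOp T (ι†)) (a := constOp T a)
    hα (inner_constOp ι) (accretive_dampedVolterra hT ρ)
    (fun x => dampedVolterra_injective hT ρ)
    (constOp_dampedVolterra hT ρ ι) (constOp_dampedVolterra hT ρ a) (constOp_coercive h)
    (v := mulLp T E (weight (-ρ)) v) (by
      simp only [dampedVolterra, ContinuousLinearMap.comp_apply, constOp_mulLp, hv,
        mulLp_mulLp (weight_mul_weight_neg ρ)])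
  rw [← mulLp_mulLp (weight_mul_weight_neg ρ) v, h0, map_zero]

end Hilbert

/-! ### Energy estimate and solution operator of the parabolic equation. -/

section SolutionOperator

variable {V H : Type*} [NormedAddCommGroup V] [InnerProductSpace ℝ V] [CompleteSpace V]
  [NormedAddCommGroup H] [InnerProductSpace ℝ H] [CompleteSpace H] {T : ℝ}

/-- The data `(F, v₀)` belonging to the function `t ↦ y₀ + ∫₀ᵗ x` in the parabolic equation
`ι†ι v' = a v + F`. -/
noncomputable def dataMap (hT : 0 ≤ T) (ι : V →L[ℝ] H) (a : V →L[ℝ] V) :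
    L2 T V × V →L[ℝ] L2 T V × H :=
  (((constOp T (ι†)).comp (constOp T ι) - (constOp T a).comp (volterra hT V)).comp
      (ContinuousLinearMap.fst ℝ _ _) -
    ((constOp T a).comp (Lp.constL 2 (timeMeasure T) ℝ)).comp
      (ContinuousLinearMap.snd ℝ _ _)).prod (ι.comp (ContinuousLinearMap.snd ℝ _ _))

theorem dataMap_apply (hT : 0 ≤ T) (ι : V →L[ℝ] H) (a : V →L[ℝ] V) (x : L2 T V) (y₀ : V) :
    dataMap hT ι a (x, y₀) = (constOp T (ι†) (constOp T ι x) - constOp T a (volterra hT V x) -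
      constOp T a (Lp.constL 2 (timeMeasure T) ℝ y₀), ι y₀) := rfl

/-- `dataMap` on the regular functions. -/
noncomputable def regData (hT : 0 ≤ T) (ι : V →L[ℝ] H) (a : V →L[ℝ] V) :
    (ℝ →ᵇ V) × V →L[ℝ] L2 T V × H :=
  (dataMap hT ι a).comp ((bcfLp T V).prodMap (ContinuousLinearMap.id ℝ V))

theorem regData_apply (hT : 0 ≤ T) (ι : V →L[ℝ] H) (a : V →L[ℝ] V) (p : (ℝ →ᵇ V) × V) :
    regData hT ι a p = dataMap hT ι a (bcfLp T V p.1, p.2) := rfl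

/-- The map is triangular: first `y₀` approximates the initial value, then `x` the source corrected
by `a y₀`. -/
theorem denseRange_dataMap (hT : 0 ≤ T) {ι : V →L[ℝ] H} (hι : DenseRange ι) {a : V →L[ℝ] V}
    {α ρ : ℝ} (hα : 0 < α) (hρ : 0 < ρ) (h : ∀ v, α * ‖v‖ ^ 2 ≤ -⟪a v, v⟫ + ρ * ‖ι v‖ ^ 2) :
    DenseRange (dataMap hT ι a (T := T)) := by
  have hd := denseRange_parabolic (T := T) hT hα hρ h
  rw [Metric.denseRange_iff]
  rintro ⟨F, h₀⟩ ε hε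
  obtain ⟨y₀, hy⟩ := Metric.denseRange_iff.1 hι h₀ ε hε
  obtain ⟨x, hx⟩ := Metric.denseRange_iff.1 hd
    (F + constOp T a (Lp.constL 2 (timeMeasure T) ℝ y₀)) ε hε
  refine ⟨(x, y₀), ?_⟩
  rw [dataMap_apply, Prod.dist_eq, max_lt_iff]
  refine ⟨?_, hy⟩
  simp only [dist_eq_norm] at hx ⊢
  rwa [sub_sub_eq_add_sub]

theorem denseRange_regData (hT : 0 ≤ T) {ι : V →L[ℝ] H} (hι : DenseRange ι) {a : V →L[ℝ] V}
    {α ρ : ℝ} (hα : 0 < α) (hρ : 0 < ρ) (h : ∀ v, α * ‖v‖ ^ 2 ≤ -⟪a v, v⟫ + ρ * ‖ι v‖ ^ 2) :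
    DenseRange (regData hT ι a (T := T)) :=
  (denseRange_dataMap hT hι hα hρ h).comp
    ((bcfLp_denseRange T V).prodMap Function.surjective_id.denseRange) (dataMap hT ι a).continuous

/-- The regular solution `t ↦ y₀ + ∫₀ᵗ x`, as an element of `L²(0,T;V) × C([0,T];H)`. -/
noncomputable def regSol (hT : 0 ≤ T) (ι : V →L[ℝ] H) :
    (ℝ →ᵇ V) × V →ₗ[ℝ] L2 T V × C(Set.Icc (0 : ℝ) T, H) where
  toFun p := (volterra hT V (bcfLp T V p.1) + Lp.constL 2 (timeMeasure T) ℝ p.2,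
    ι.compLeftContinuous ℝ _ (primC T V (bcfLp T V p.1)) +
      ContinuousMap.const _ (ι p.2))
  map_add' p q := by
    refine Prod.ext ?_ ?_
    · simp only [Prod.fst_add, Prod.snd_add, map_add]
      abel
    · ext t
      simp only [Prod.fst_add, Prod.snd_add, map_add, ContinuousMap.add_apply,
        ContinuousMap.const_apply]
      abel
  map_smul' c p := by
    refine Prod.ext ?_ ?_
    · simp only [Prod.smul_fst, Prod.smul_snd, map_smul, RingHom.id_apply, smul_add]
    · ext t
      simp only [Prod.smul_fst, Prod.smul_snd, map_smul, RingHom.id_apply, smul_add,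
        ContinuousMap.add_apply, ContinuousMap.smul_apply, ContinuousMap.const_apply]

omit [CompleteSpace V] [CompleteSpace H] in
theorem regSol_fst (hT : 0 ≤ T) (ι : V →L[ℝ] H) (p : (ℝ →ᵇ V) × V) :
    (regSol hT ι p (T := T)).1 =
      volterra hT V (bcfLp T V p.1) + Lp.constL 2 (timeMeasure T) ℝ p.2 := rfl

omit [CompleteSpace V] [CompleteSpace H] in
theorem regSol_snd_apply (hT : 0 ≤ T) (ι : V →L[ℝ] H) (p : (ℝ →ᵇ V) × V)
    (t : Set.Icc (0 : ℝ) T) :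
    (regSol hT ι p).2 t = ι (p.2 + ∫ s in (0 : ℝ)..t, p.1 s) := by
  rw [add_comm, map_add, ← primC_bcfLp]
  rfl

omit [CompleteSpace V] [CompleteSpace H] in
theorem coeFn_regSol_fst (hT : 0 ≤ T) (ι : V →L[ℝ] H) (p : (ℝ →ᵇ V) × V) :
    (regSol hT ι p).1 =ᵐ[timeMeasure T] fun t => p.2 + ∫ s in (0 : ℝ)..t, p.1 s := by
  rw [regSol_fst]
  filter_upwards [coeFn_volterra_bcfLp hT p.1, Lp.coeFn_const (p := 2) (μ := timeMeasure T) p.2,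
    Lp.coeFn_add (volterra hT V (bcfLp T V p.1)) (Lp.constL 2 (timeMeasure T) ℝ p.2)]
    with t h1 h2 h3
  rw [h3, Pi.add_apply, h1, add_comm]
  congr 1

theorem regData_fst (hT : 0 ≤ T) (ι : V →L[ℝ] H) (a : V →L[ℝ] V) (p : (ℝ →ᵇ V) × V) :
    (regData hT ι a p).1 = constOp T (ι†) (constOp T ι (bcfLp T V p.1)) -
      constOp T a (regSol hT ι p).1 := by
  rw [regData_apply, dataMap_apply, regSol_fst, map_add]
  exact sub_sub _ _ _

theorem coeFn_regData_fst (hT : 0 ≤ T) (ι : V →L[ℝ] H) (a : V →L[ℝ] V) (p : (ℝ →ᵇ V) × V) :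
    (regData hT ι a p).1 =ᵐ[timeMeasure T]
      fun t => (ι†) (ι (p.1 t)) - a (p.2 + ∫ s in (0 : ℝ)..t, p.1 s) := by
  rw [regData_fst]
  filter_upwards [coeFn_regSol_fst hT ι p, coeFn_bcfLp (T := T) p.1,
    coeFn_constOp (ι†) (constOp T ι (bcfLp T V p.1)), coeFn_constOp ι (bcfLp T V p.1),
    coeFn_constOp a (regSol hT ι p).1, Lp.coeFn_sub
      (constOp T (ι†) (constOp T ι (bcfLp T V p.1))) (constOp T a (regSol hT ι p).1)]
    with t h1 h2 h3 h4 h5 h6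
  rw [h6, Pi.sub_apply, h3, h4, h2, h5, h1]

omit [CompleteSpace V] [CompleteSpace H] in
theorem constOp_sub (a b : V →L[ℝ] H) (f : L2 T V) :
    constOp T (a - b) f = constOp T a f - constOp T b f := by
  refine Lp.ext ?_
  filter_upwards [coeFn_constOp (a - b) f, coeFn_constOp a f, coeFn_constOp b f,
    Lp.coeFn_sub (constOp T a f) (constOp T b f)] with t h1 h2 h3 h4
  rw [h1, h4, Pi.sub_apply, h2, h3, sub_apply]

-- Young's inequality spends one of the two copies of `α ‖v‖²` from coercivity on `2 ⟪F, v⟫`. In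
-- use, `e` is the weight `exp (-2ρr)`, bounded below by `c = exp (-2ρT)`.
omit [CompleteSpace V] [CompleteSpace H] in
theorem energy_pointwise {ι : V →L[ℝ] H} {a : V →L[ℝ] V} {α ρ e c : ℝ} (hα : 0 < α)
    (h : ∀ v, α * ‖v‖ ^ 2 ≤ -⟪a v, v⟫ + ρ * ‖ι v‖ ^ 2) (hc : c ≤ e) (he : 0 ≤ e) (he1 : e ≤ 1)
    (v F : V) :
    e * (2 * (⟪F, v⟫ + ⟪a v, v⟫) - 2 * ρ * ‖ι v‖ ^ 2) ≤
      1 / α * ⟪F, F⟫ - α * c * ⟪v, v⟫ := by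
  rw [real_inner_self_eq_norm_sq, real_inner_self_eq_norm_sq]
  have h1 : 2 * ⟪F, v⟫ ≤ 1 / α * ‖F‖ ^ 2 + α * ‖v‖ ^ 2 := by
    have h2 := real_inner_le_norm F v
    have h3 : 0 ≤ 1 / α * (‖F‖ - α * ‖v‖) ^ 2 := by positivity
    have h4 : 1 / α * (‖F‖ - α * ‖v‖) ^ 2 = 1 / α * ‖F‖ ^ 2 - 2 * (‖F‖ * ‖v‖) + α * ‖v‖ ^ 2 := by
      field_simp
      ring
    linarith
  have h5 := h v
  calc e * (2 * (⟪F, v⟫ + ⟪a v, v⟫) - 2 * ρ * ‖ι v‖ ^ 2)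
      ≤ e * (1 / α * ‖F‖ ^ 2 - α * ‖v‖ ^ 2) := by
        refine mul_le_mul_of_nonneg_left ?_ he
        linarith
    _ = e * (1 / α * ‖F‖ ^ 2) - e * (α * ‖v‖ ^ 2) := by ring
    _ ≤ 1 * (1 / α * ‖F‖ ^ 2) - c * (α * ‖v‖ ^ 2) := by gcongr
    _ = _ := by ring

/-- Since `ι†ι v' = F + a v`, the derivative of `exp (-2ρt) ‖ι v‖²` is the left side of
`energy_pointwise`; integrate over `[0,t]`. -/
theorem energy_estimate (hT : 0 ≤ T) {ι : V →L[ℝ] H} {a : V →L[ℝ] V} {α ρ : ℝ} (hα : 0 < α)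
    (hρ : 0 < ρ) (h : ∀ v, α * ‖v‖ ^ 2 ≤ -⟪a v, v⟫ + ρ * ‖ι v‖ ^ 2) (p : (ℝ →ᵇ V) × V)
    {t : ℝ} (ht : t ∈ Set.Icc 0 T) :
    Real.exp (-(2 * ρ) * t) * ‖ι (p.2 + ∫ s in (0 : ℝ)..t, p.1 s)‖ ^ 2 +
      α * Real.exp (-(2 * ρ) * T) * ∫ r in (0 : ℝ)..t,
        ⟪p.2 + ∫ s in (0 : ℝ)..r, p.1 s, p.2 + ∫ s in (0 : ℝ)..r, p.1 s⟫ ≤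
      ‖ι p.2‖ ^ 2 + 1 / α * ‖(regData hT ι a p).1‖ ^ 2 := by
  set x := p.1 with hx
  set v : ℝ → V := fun t => p.2 + ∫ s in (0 : ℝ)..t, x s with hv
  set F : ℝ → V := fun t => (ι†) (ι (x t)) - a (v t) with hF
  have hvd : ∀ t, HasDerivAt v (x t) t := fun t => (hasDerivAt_primitive x t).const_add _
  have hvc : Continuous v := continuous_iff_continuousAt.2 fun t => (hvd t).continuousAt
  have hxc : Continuous x := x.continuous
  have hFc : Continuous F := by fun_prop
  have hιd : ∀ t, HasDerivAt (fun t => ι (v t)) (ι (x t)) t := fun t =>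
    ι.hasFDerivAt.comp_hasDerivAt t (hvd t)
  have hEd : ∀ t, HasDerivAt (fun t => Real.exp (-(2 * ρ) * t) * ‖ι (v t)‖ ^ 2)
      (Real.exp (-(2 * ρ) * t) * (2 * (⟪F t, v t⟫ + ⟪a (v t), v t⟫) -
        2 * ρ * ‖ι (v t)‖ ^ 2)) t := fun t => by
    have h1 : HasDerivAt (fun t => Real.exp (-(2 * ρ) * t))
        (Real.exp (-(2 * ρ) * t) * -(2 * ρ)) t := by
      simpa using ((hasDerivAt_id t).const_mul (-(2 * ρ))).exp
    refine (h1.mul (hιd t).norm_sq).congr_deriv ?_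
    rw [← inner_add_left, hF, sub_add_cancel, ContinuousLinearMap.adjoint_inner_left,
      real_inner_comm (ι (v t))]
    ring
  have hdc : Continuous fun t => Real.exp (-(2 * ρ) * t) * (2 * (⟪F t, v t⟫ + ⟪a (v t), v t⟫) -
        2 * ρ * ‖ι (v t)‖ ^ 2) := by fun_prop
  have hFF : Continuous fun t => 1 / α * ⟪F t, F t⟫ := by fun_prop
  have hvv : Continuous fun t => α * Real.exp (-(2 * ρ) * T) * ⟪v t, v t⟫ := by fun_prop
  have hFv : Continuous fun t => 1 / α * ⟪F t, F t⟫ - α * Real.exp (-(2 * ρ) * T) * ⟪v t, v t⟫ :=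
    hFF.sub hvv
  have h1 := intervalIntegral.integral_eq_sub_of_hasDerivAt (a := 0) (b := t) (fun t _ => hEd t)
    (hdc.intervalIntegrable _ _)
  have h2 := intervalIntegral.integral_mono_on (μ := volume) ht.1 (hdc.intervalIntegrable _ _)
    (hFv.intervalIntegrable _ _) fun r hr =>
      energy_pointwise hα h (e := Real.exp (-(2 * ρ) * r)) (c := Real.exp (-(2 * ρ) * T))
        (Real.exp_le_exp.2 (by nlinarith [hr.2, ht.2])) (Real.exp_nonneg _)
        (Real.exp_le_one_iff.2 (by nlinarith [hr.1])) (v r) (F r)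
  rw [h1, intervalIntegral.integral_sub (hFF.intervalIntegrable _ _)
    (hvv.intervalIntegrable _ _), intervalIntegral.integral_const_mul,
    intervalIntegral.integral_const_mul] at h2
  have h3 : ∫ r in (0 : ℝ)..t, ⟪F r, F r⟫ ≤ ‖(regData hT ι a p).1‖ ^ 2 := by
    rw [← real_inner_self_eq_norm_sq, inner_eq_intervalIntegral hT (coeFn_regData_fst hT ι a p)
      (coeFn_regData_fst hT ι a p)]
    refine intervalIntegral.integral_mono_interval le_rfl ht.1 ht.2
      (Filter.Eventually.of_forall fun r => real_inner_self_nonneg) ?_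
    exact (hFc.inner hFc).intervalIntegrable _ _
  have h4 : v 0 = p.2 := by simp [hv]
  have h5 : 1 / α * ∫ r in (0 : ℝ)..t, ⟪F r, F r⟫ ≤ 1 / α * ‖(regData hT ι a p).1‖ ^ 2 := by
    gcongr
  simp only [h4, mul_zero, Real.exp_zero, one_mul] at h2
  linarith

/-- The constant in the a priori estimate. -/
noncomputable def aprioriConst (T α ρ : ℝ) : ℝ := (1 + 1 / α) * Real.exp (ρ * T)

theorem aprioriConst_nonneg {T α ρ : ℝ} (hα : 0 < α) : 0 ≤ aprioriConst T α ρ := by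
  unfold aprioriConst; positivity

theorem norm_regSol_le (hT : 0 ≤ T) {ι : V →L[ℝ] H} {a : V →L[ℝ] V} {α ρ : ℝ} (hα : 0 < α)
    (hρ : 0 < ρ) (h : ∀ v, α * ‖v‖ ^ 2 ≤ -⟪a v, v⟫ + ρ * ‖ι v‖ ^ 2) (p : (ℝ →ᵇ V) × V) :
    ‖regSol hT ι p (T := T)‖ ≤ aprioriConst T α ρ * ‖regData hT ι a p (T := T)‖ := by
  set D := ‖regData hT ι a p‖ with hD
  have hM := aprioriConst_nonneg (T := T) (ρ := ρ) hα
  have hr : 0 ≤ aprioriConst T α ρ * D := mul_nonneg hM (norm_nonneg _)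
  have hsum : ‖ι p.2‖ ^ 2 + 1 / α * ‖(regData hT ι a p).1‖ ^ 2 ≤ (1 + 1 / α) * D ^ 2 := by
    have h1 : ‖ι p.2‖ ≤ D := norm_snd_le (regData hT ι a p)
    have h2 : ‖(regData hT ι a p).1‖ ≤ D := norm_fst_le (regData hT ι a p)
    calc _ ≤ D ^ 2 + 1 / α * D ^ 2 := by gcongr
      _ = _ := by ring
  have hexp : ∀ t, Real.exp (2 * ρ * t) * Real.exp (-(2 * ρ) * t) = 1 := fun t => by
    rw [← Real.exp_add]; simp
  -- With `B` as below, the squared norms of the two components are at most `(1/α) B` and `B`; the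
  -- factor `1 + 1/α` dominates both.
  have hsq : (aprioriConst T α ρ * D) ^ 2 =
      (1 + 1 / α) * (Real.exp (2 * ρ * T) * ((1 + 1 / α) * D ^ 2)) := by
    have : Real.exp (2 * ρ * T) = Real.exp (ρ * T) ^ 2 := by
      rw [← Real.exp_nat_mul]; ring_nf
    rw [this, aprioriConst]
    ring
  have hα1 : 0 < 1 / α := by positivity
  set B := Real.exp (2 * ρ * T) * ((1 + 1 / α) * D ^ 2) with hB
  have hB0 : 0 ≤ B := by positivity
  have hvv : ∀ t ∈ Set.Icc 0 T, 0 ≤ ∫ r in (0 : ℝ)..t,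
        ⟪p.2 + ∫ s in (0 : ℝ)..r, p.1 s, p.2 + ∫ s in (0 : ℝ)..r, p.1 s⟫ := fun t ht =>
    intervalIntegral.integral_nonneg ht.1 fun _ _ => real_inner_self_nonneg
  rw [Prod.norm_def, max_le_iff]
  constructor
  · refine abs_le_of_sq_le_sq' ?_ hr |>.2
    have h1 := energy_estimate hT hα hρ h p (right_mem_Icc.2 hT)
    rw [← inner_eq_intervalIntegral hT (coeFn_regSol_fst hT ι p) (coeFn_regSol_fst hT ι p),
      real_inner_self_eq_norm_sq] at h1
    have h2 : α * Real.exp (-(2 * ρ) * T) * ‖(regSol hT ι p).1‖ ^ 2 ≤ (1 + 1 / α) * D ^ 2 := by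
      have : 0 ≤ Real.exp (-(2 * ρ) * T) * ‖ι (p.2 + ∫ s in (0 : ℝ)..T, p.1 s)‖ ^ 2 := by
        positivity
      linarith
    have h3 : ‖(regSol hT ι p).1‖ ^ 2 ≤ 1 / α * B := by
      calc ‖(regSol hT ι p).1‖ ^ 2 = 1 / α * Real.exp (2 * ρ * T) *
          (α * Real.exp (-(2 * ρ) * T) * ‖(regSol hT ι p).1‖ ^ 2) := by
            have := hexp T
            have h4 : 1 / α * α = 1 := by field_simp
            calc _ = (1 / α * α) * (Real.exp (2 * ρ * T) * Real.exp (-(2 * ρ) * T)) *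
                ‖(regSol hT ι p).1‖ ^ 2 := by rw [this, h4]; ring
              _ = _ := by ring
        _ ≤ 1 / α * Real.exp (2 * ρ * T) * ((1 + 1 / α) * D ^ 2) := by gcongr
        _ = _ := by rw [hB]; ring
    rw [hsq]
    linarith
  · refine (ContinuousMap.norm_le _ hr).2 fun t => ?_
    rw [regSol_snd_apply]
    refine abs_le_of_sq_le_sq' ?_ hr |>.2
    have h1 := energy_estimate hT hα hρ h p t.2
    have h0 := mul_nonneg (by positivity : 0 ≤ α * Real.exp (-(2 * ρ) * T)) (hvv t t.2)
    have h2 : Real.exp (-(2 * ρ) * t) * ‖ι (p.2 + ∫ s in (0 : ℝ)..t, p.1 s)‖ ^ 2 ≤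
        (1 + 1 / α) * D ^ 2 := by linarith
    have h3 : ‖ι (p.2 + ∫ s in (0 : ℝ)..t, p.1 s)‖ ^ 2 ≤ B := by
      calc ‖ι (p.2 + ∫ s in (0 : ℝ)..t, p.1 s)‖ ^ 2 = Real.exp (2 * ρ * t) *
          (Real.exp (-(2 * ρ) * t) * ‖ι (p.2 + ∫ s in (0 : ℝ)..t, p.1 s)‖ ^ 2) := by
            rw [← mul_assoc, hexp, one_mul]
        _ ≤ Real.exp (2 * ρ * t) * ((1 + 1 / α) * D ^ 2) := by gcongr
        _ ≤ _ := by
          rw [hB]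
          have := t.2.2
          gcongr
    rw [hsq]
    nlinarith

/-- The solution operator `(F, y₀) ↦ (v, y)` of the equation `ι†ι v' = a v + F`, `ι v(0) = y₀`. -/
noncomputable def solOp (hT : 0 ≤ T) (ι : V →L[ℝ] H) (a : V →L[ℝ] V) :
    L2 T V × H →L[ℝ] L2 T V × C(Set.Icc (0 : ℝ) T, H) :=
  (regSol hT ι).extendOfNorm (regData hT ι a).toLinearMap

variable (hT : 0 ≤ T) {ι : V →L[ℝ] H} (hι : DenseRange ι) {a : V →L[ℝ] V} {α ρ : ℝ}
  (hα : 0 < α) (hρ : 0 < ρ) (h : ∀ v, α * ‖v‖ ^ 2 ≤ -⟪a v, v⟫ + ρ * ‖ι v‖ ^ 2)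

include hι hα hρ h

theorem solOp_regData (p : (ℝ →ᵇ V) × V) : solOp hT ι a (regData hT ι a p) = regSol hT ι p :=
  LinearMap.extendOfNorm_eq (e := (regData hT ι a).toLinearMap) (denseRange_regData hT hι hα hρ h)
    ⟨_, norm_regSol_le hT hα hρ h⟩ p

theorem norm_solOp_le (d : L2 T V × H) : ‖solOp hT ι a d‖ ≤ aprioriConst T α ρ * ‖d‖ :=
  LinearMap.norm_extendOfNorm_apply_le (e := (regData hT ι a).toLinearMap)
    (denseRange_regData hT hι hα hρ h) _ (norm_regSol_le hT hα hρ h) d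

/-- This and the next two lemmas state closed conditions on `d`, so they need checking only on the
dense set of regular data. -/
theorem constOp_solOp_fst (d : L2 T V × H) :
    constOp T ι (solOp hT ι a d).1 = contLp hT H (solOp hT ι a d).2 := by
  refine (denseRange_regData hT hι hα hρ h).induction_on d
    (isClosed_eq (by fun_prop) (by fun_prop)) fun p => ?_
  rw [solOp_regData hT hι hα hρ h]
  refine Lp.ext ?_
  filter_upwards [coeFn_constOp ι (regSol hT ι p).1, coeFn_regSol_fst hT ι p,
    coeFn_contLp hT (regSol hT ι p).2, ae_restrict_mem measurableSet_Ioo] with t h1 h2 h3 ht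
  rw [h1, h2, h3, Set.IccExtend_of_mem _ _ (Ioo_subset_Icc_self ht), regSol_snd_apply]

theorem solOp_snd_zero (d : L2 T V × H) :
    (solOp hT ι a d).2 ⟨0, left_mem_Icc.2 hT⟩ = d.2 := by
  refine (denseRange_regData hT hι hα hρ h).induction_on d
    (isClosed_eq ((continuous_eval_const _).comp (by fun_prop)) (by fun_prop))
    fun p => ?_
  rw [solOp_regData hT hι hα hρ h, regSol_snd_apply]
  simp [regData_apply, dataMap_apply]

theorem hasWeakTimeDeriv_solOp (d : L2 T V × H) :
    HasWeakTimeDeriv T (constOp T (ι†) (constOp T ι (solOp hT ι a d).1))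
      (constOp T a (solOp hT ι a d).1 + d.1 : L2 T V) := by
  intro φ hφ hφc hsupp
  have hφ' : Continuous (deriv φ) := hφ.continuous_deriv (by simp)
  refine (denseRange_regData hT hι hα hρ h).induction_on d
    (isClosed_eq ((continuous_integral_mul ⟨deriv φ, hφ'⟩).comp (by fun_prop))
      ((continuous_integral_mul ⟨φ, hφ.continuous⟩).comp (by fun_prop)).neg) fun p => ?_
  -- For regular data the right side `a v + F` is `ι†ι x`.
  rw [solOp_regData hT hι hα hρ h, regData_fst, add_sub_cancel]
  have h1 := hasWeakTimeDeriv_volterra hT (constOp T (ι†) (constOp T ι (bcfLp T V p.1)))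
    φ hφ hφc hsupp
  rw [← h1, regSol_fst, map_add, map_add, constOp_volterra, constOp_volterra]
  set w : L2 T V := volterra hT V (constOp T (ι†) (constOp T ι (bcfLp T V p.1))) with hw
  have h2 : ∀ᵐ t ∂timeMeasure T, (w + constOp T (ι†) (constOp T ι
      (Lp.constL 2 (timeMeasure T) ℝ p.2)) : L2 T V) t = w t + (ι†) (ι p.2) := by
    filter_upwards [Lp.coeFn_add w (constOp T (ι†) (constOp T ι
      (Lp.constL 2 (timeMeasure T) ℝ p.2))), Lp.coeFn_const (p := 2) (μ := timeMeasure T) p.2,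
      coeFn_constOp (ι†) (constOp T ι (Lp.constL 2 (timeMeasure T) ℝ p.2)),
      coeFn_constOp ι (Lp.constL 2 (timeMeasure T) ℝ p.2)] with t h3 h4 h5 h6
    rw [h3, Pi.add_apply, h5, h6]
    congr 3
  -- Hence the constant part `ι†ι y₀` contributes nothing.
  have h3 : ∫ t in Ioo 0 T, deriv φ t = 0 := by
    rw [setIntegral_Ioo_eq hT, intervalIntegral.integral_eq_sub_of_hasDerivAt
      (fun t _ => (hφ.differentiable (by simp)).differentiableAt.hasDerivAt)
      (hφ'.intervalIntegrable _ _), (eq_zero_of_tsupport_subset hsupp).1,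
      (eq_zero_of_tsupport_subset hsupp).2, sub_zero]
  have h4 : Integrable (fun t => deriv φ t • w t) (timeMeasure T) :=
    (memLp_mul hφ' w).integrable one_le_two
  have h5 : Integrable (fun t => deriv φ t • (ι†) (ι p.2)) (timeMeasure T) := by
    have : IntegrableOn (deriv φ) (Ioo 0 T) :=
      (hφ'.continuousOn.integrableOn_compact isCompact_Icc).mono_set Ioo_subset_Icc_self
    exact Integrable.smul_const this _
  have h6 : ∫ t in Ioo 0 T, deriv φ t • (w + constOp T (ι†) (constOp T ι
      (Lp.constL 2 (timeMeasure T) ℝ p.2)) : L2 T V) t =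
      ∫ t in Ioo 0 T, (deriv φ t • w t + deriv φ t • (ι†) (ι p.2)) := by
    refine integral_congr_ae ?_
    filter_upwards [h2] with t ht
    rw [ht, smul_add]
  rw [h6, integral_add h4 h5, integral_smul_const, h3, zero_smul, add_zero]

/-- The dependence of the solution on the operator. -/
theorem solOp_perturb {a' : V →L[ℝ] V} (h' : ∀ v, α * ‖v‖ ^ 2 ≤ -⟪a' v, v⟫ + ρ * ‖ι v‖ ^ 2)
    (d : L2 T V × H) :
    solOp hT ι a' d = solOp hT ι a (d + (constOp T (a' - a) (solOp hT ι a' d).1, 0)) := by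
  refine (denseRange_regData hT hι hα hρ h').induction_on d
    (isClosed_eq (by fun_prop) (by fun_prop)) fun p => ?_
  -- A regular solution does not involve the operator; replacing `a'` by `a` changes only its
  -- source, by `(a' - a) v`.
  rw [solOp_regData hT hι hα hρ h', ← solOp_regData hT hι hα hρ h p]
  congr 1
  refine Prod.ext ?_ ?_
  · rw [Prod.fst_add, regData_fst, regData_fst, solOp_regData hT hι hα hρ h,
      constOp_sub]
    exact (sub_add_sub_cancel _ _ _).symm
  · simp [regData_apply, dataMap_apply]

end SolutionOperator

/-! ### The Riesz isomorphism between `V'` and `V`. -/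

section Riesz

variable (V : Type*) [NormedAddCommGroup V] [InnerProductSpace ℝ V] [CompleteSpace V]

/-- The Riesz isomorphism `V' → V` as a real linear map. -/
noncomputable def riesz : StrongDual ℝ V →L[ℝ] V :=
  LinearMap.mkContinuous
    { toFun := fun f => (InnerProductSpace.toDual ℝ V).symm f
      map_add' := fun f g => map_add _ f g
      map_smul' := fun c f => by simp } 1 (fun f => by simp)

/-- The inverse `V → V'` of the Riesz isomorphism. -/
noncomputable def rieszInv : V →L[ℝ] StrongDual ℝ V :=
  LinearMap.mkContinuous
    { toFun := fun v => InnerProductSpace.toDual ℝ V v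
      map_add' := fun f g => map_add _ f g
      map_smul' := fun c f => by simp } 1 (fun f => by simp)

variable {V}

theorem inner_riesz (f : StrongDual ℝ V) (v : V) : ⟪riesz V f, v⟫ = f v :=
  InnerProductSpace.toDual_symm_apply

theorem rieszInv_apply (v w : V) : rieszInv V v w = ⟪v, w⟫ :=
  InnerProductSpace.toDual_apply_apply

theorem rieszInv_riesz (f : StrongDual ℝ V) : rieszInv V (riesz V f) = f :=
  (InnerProductSpace.toDual ℝ V).apply_symm_apply f

theorem riesz_rieszInv (v : V) : riesz V (rieszInv V v) = v :=
  (InnerProductSpace.toDual ℝ V).symm_apply_apply v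

end Riesz

/-! ### Well-posedness of the state equation and dependence on `σ` and `u`. -/

namespace Problem

variable {U V H : Type*}
  [NormedAddCommGroup U] [InnerProductSpace ℝ U]
  [NormedAddCommGroup V] [InnerProductSpace ℝ V] [CompleteSpace V]
  [NormedAddCommGroup H] [InnerProductSpace ℝ H] [CompleteSpace H]
  (Q : Problem U V H)

/-- The operator `A(σ)` composed with the Riesz isomorphism. -/
noncomputable def opA (σ : Param) : V →L[ℝ] V := (riesz V).comp (Q.A σ)

omit [CompleteSpace H] in
theorem continuous_opA : Continuous Q.opA :=
  (continuous_const (y := riesz V)).clm_comp Q.A_continuous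

-- Raising `ρ` to `max ρ 1` keeps coercivity and makes `ρ` positive, as the accretivity argument
-- requires.
omit [CompleteSpace H] in
theorem exists_coercive : ∃ ρ α : ℝ, 0 < ρ ∧ 0 < α ∧ ∀ (σ : Param) (v : V),
    α * ‖v‖ ^ 2 ≤ -⟪Q.opA σ v, v⟫ + ρ * ‖Q.ι v‖ ^ 2 := by
  obtain ⟨ρ, α, hα, h⟩ := Q.A_coercive
  refine ⟨max ρ 1, α, by positivity, hα, fun σ v => ?_⟩
  rw [opA, ContinuousLinearMap.comp_apply, inner_riesz]
  refine (h σ v).trans ?_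
  gcongr
  exact le_max_left _ _

theorem toDual_eq (x : H) : Q.toDual x = rieszInv V ((Q.ι†) x) := by
  ext v
  rw [rieszInv_apply, ContinuousLinearMap.adjoint_inner_left]
  rfl

/-- The right hand side of the state equation and the initial value, as data for `solOp`. -/
noncomputable def data (u : L2 Q.T U) : L2 Q.T V × H :=
  (constOp Q.T ((Q.ι†).comp Q.B) u + constOp Q.T (riesz V) Q.f, Q.y₀)

theorem coeFn_data (u : L2 Q.T U) : (Q.data u).1 =ᵐ[timeMeasure Q.T]
    fun t => riesz V (Q.toDual (Q.B (u t)) + Q.f t) := by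
  filter_upwards [coeFn_constOp ((Q.ι†).comp Q.B) u, coeFn_constOp (riesz V) Q.f,
    Lp.coeFn_add (constOp Q.T ((Q.ι†).comp Q.B) u) (constOp Q.T (riesz V) Q.f)] with t h1 h2 h3
  rw [data, h3, Pi.add_apply, h1, h2, map_add, toDual_eq, riesz_rieszInv]
  rfl

omit [CompleteSpace V] [CompleteSpace H] in
theorem eval_eq (y : C(Set.Icc (0 : ℝ) Q.T, H)) (t : Set.Icc (0 : ℝ) Q.T) : Q.eval y t = y t :=
  Set.IccExtend_val _ _ _

omit [CompleteSpace V] [CompleteSpace H] in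
theorem continuous_eval (y : C(Set.Icc (0 : ℝ) Q.T, H)) : Continuous (Q.eval y) :=
  y.continuous.Icc_extend'

/-- The trajectory produced by the solution operator. -/
noncomputable def traj (u : L2 Q.T U) (σ : Param) : C(Set.Icc (0 : ℝ) Q.T, H) :=
  (solOp Q.T_pos.le Q.ι (Q.opA σ) (Q.data u)).2

theorem isState_traj (σ : Param) (u : L2 Q.T U) : Q.IsState σ u (Q.traj u σ) := by
  obtain ⟨ρ, α, hρ, hα, h⟩ := Q.exists_coercive
  set s := solOp Q.T_pos.le Q.ι (Q.opA σ) (Q.data u) with hs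
  refine ⟨s.1, constOp Q.T (rieszInv V) (constOp Q.T (Q.opA σ) s.1 + (Q.data u).1), ?_, ?_, ?_, ?_⟩
  · refine ((hasWeakTimeDeriv_solOp Q.T_pos.le Q.ι_denseRange hα hρ (h σ) (Q.data u)).constOp
      (rieszInv V)).congr ?_ (ae_eq_refl _)
    filter_upwards [coeFn_constOp (rieszInv V) (constOp Q.T (Q.ι†) (constOp Q.T Q.ι s.1)),
      coeFn_constOp (Q.ι†) (constOp Q.T Q.ι s.1), coeFn_constOp Q.ι s.1] with t h1 h2 h3
    rw [h1, h2, h3, toDual_eq]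
  · filter_upwards [coeFn_constOp Q.ι s.1, coeFn_contLp Q.T_pos.le s.2] with t h1 h2
    rw [← h1, constOp_solOp_fst Q.T_pos.le Q.ι_denseRange hα hρ (h σ), h2]
    rfl
  · filter_upwards [coeFn_constOp (rieszInv V) (constOp Q.T (Q.opA σ) s.1 + (Q.data u).1),
      Lp.coeFn_add (constOp Q.T (Q.opA σ) s.1) (Q.data u).1, Q.coeFn_data u,
      coeFn_constOp (Q.opA σ) s.1] with t h1 h2 h3 h4
    rw [h1, h2, Pi.add_apply, h3, h4, map_add, rieszInv_riesz, opA,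
      ContinuousLinearMap.comp_apply, rieszInv_riesz, add_assoc]
  · exact (Q.eval_eq _ ⟨0, left_mem_Icc.2 Q.T_pos.le⟩).trans
      (solOp_snd_zero Q.T_pos.le Q.ι_denseRange hα hρ (h σ) (Q.data u))

/-- The weak formulation transported to `V`. -/
theorem IsState.exists_riesz {Q : Problem U V H} {σ : Param} {u : L2 Q.T U}
    {y : C(Set.Icc (0 : ℝ) Q.T, H)} (hy : Q.IsState σ u y) :
    ∃ v : L2 Q.T V, HasWeakTimeDeriv Q.T (constOp Q.T (Q.ι†) (constOp Q.T Q.ι v))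
        (constOp Q.T (Q.opA σ) v + (Q.data u).1 : L2 Q.T V) ∧
      constOp Q.T Q.ι v = contLp Q.T_pos.le H y ∧ y ⟨0, left_mem_Icc.2 Q.T_pos.le⟩ = Q.y₀ := by
  obtain ⟨v, dv, hw, hv, heq, h0⟩ := hy
  have hv' : constOp Q.T Q.ι v = contLp Q.T_pos.le H y := by
    refine Lp.ext ?_
    filter_upwards [coeFn_constOp Q.ι v, coeFn_contLp Q.T_pos.le y, hv] with t h1 h2 h3
    rw [h1, h2, h3]
    rfl
  refine ⟨v, ?_, hv', (Q.eval_eq _ ⟨0, left_mem_Icc.2 Q.T_pos.le⟩).symm.trans h0⟩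
  have h1 : HasWeakTimeDeriv Q.T
      (constOp Q.T (rieszInv V) (constOp Q.T (Q.ι†) (constOp Q.T Q.ι v))) dv := by
    refine hw.congr ?_ (ae_eq_refl _)
    filter_upwards [coeFn_constOp (rieszInv V) (constOp Q.T (Q.ι†) (constOp Q.T Q.ι v)),
      coeFn_constOp (Q.ι†) (constOp Q.T Q.ι v), coeFn_constOp Q.ι v] with t h1 h2 h3
    rw [h1, h2, h3, toDual_eq]
  refine (h1.constOp (riesz V)).congr ?_ ?_
  · filter_upwards [coeFn_constOp (riesz V)
      (constOp Q.T (rieszInv V) (constOp Q.T (Q.ι†) (constOp Q.T Q.ι v))),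
      coeFn_constOp (rieszInv V) (constOp Q.T (Q.ι†) (constOp Q.T Q.ι v))] with t h1 h2
    rw [h1, h2, riesz_rieszInv]
  · filter_upwards [coeFn_constOp (riesz V) dv, heq, Q.coeFn_data u,
      Lp.coeFn_add (constOp Q.T (Q.opA σ) v) (Q.data u).1, coeFn_constOp (Q.opA σ) v]
      with t h1 h2 h3 h4 h5
    rw [h1, h2, h4, Pi.add_apply, h3, h5, add_assoc, map_add]
    rfl

/-- The difference `w` satisfies `(ι†ι w)' = a w` weakly, so `k = ι†ι w - ∫₀ᵗ a w` is a constant.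
The common initial value makes it zero, and `eq_zero_of_parabolic` applies. -/
theorem IsState.unique {Q : Problem U V H} {σ : Param} {u : L2 Q.T U}
    {y₁ y₂ : C(Set.Icc (0 : ℝ) Q.T, H)} (h₁ : Q.IsState σ u y₁) (h₂ : Q.IsState σ u y₂) :
    y₁ = y₂ := by
  obtain ⟨ρ, α, -, hα, h⟩ := Q.exists_coercive
  obtain ⟨v₁, hw₁, hv₁, h01⟩ := h₁.exists_riesz
  obtain ⟨v₂, hw₂, hv₂, h02⟩ := h₂.exists_riesz
  have hT := Q.T_pos
  set w := v₁ - v₂ with hw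
  set y := y₁ - y₂ with hy
  have hwy : constOp Q.T Q.ι w = contLp hT.le H y := by rw [hw, hy, map_sub, map_sub, hv₁, hv₂]
  have hy0 : y ⟨0, left_mem_Icc.2 hT.le⟩ = 0 := by
    rw [hy, ContinuousMap.sub_apply, h01, h02, sub_self]
  set k : L2 Q.T V := constOp Q.T (Q.ι†) (constOp Q.T Q.ι w) -
    volterra hT.le V (constOp Q.T (Q.opA σ) w) with hk
  have hwk : HasWeakTimeDeriv Q.T k (0 : ℝ → V) := by
    have h3 := (hw₁.sub hw₂).sub (hasWeakTimeDeriv_volterra hT.le (constOp Q.T (Q.opA σ) w))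
    rw [← map_sub, ← map_sub, ← hw, add_sub_add_right_eq_sub, ← map_sub, ← hw, sub_self] at h3
    exact h3.congr (ae_eq_refl _) (Lp.coeFn_zero V 2 (timeMeasure Q.T))
  obtain ⟨c, hc⟩ := exists_ae_eq_const_of_weakDeriv_zero hT (integrable_coe k) hwk
  -- The continuous representative of `k`, which can be evaluated at `t = 0`.
  set G : ℝ → V := fun t => (Q.ι†) (Q.eval y t) -
    ∫ s in (0 : ℝ)..t, constOp Q.T (Q.opA σ) w s ∂timeMeasure Q.T with hG
  have hkG : k =ᵐ[timeMeasure Q.T] G := by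
    filter_upwards [coeFn_constOp (Q.ι†) (constOp Q.T Q.ι w),
      coeFn_volterra hT.le (constOp Q.T (Q.opA σ) w), coeFn_contLp hT.le y,
      Lp.coeFn_sub (constOp Q.T (Q.ι†) (constOp Q.T Q.ι w))
        (volterra hT.le V (constOp Q.T (Q.opA σ) w))] with t h1 h2 h3 h4
    rw [h4, Pi.sub_apply, h1, h2, hwy, h3]
    rfl
  have hGc : Continuous G := ((Q.ι†).continuous.comp (Q.continuous_eval y)).sub
    (intervalIntegral.continuous_primitive
      (fun a b => (integrable_coe (constOp Q.T (Q.opA σ) w)).intervalIntegrable) 0)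
  have hGeq : EqOn G (fun _ => c) (Ioo 0 Q.T) :=
    Measure.eqOn_open_of_ae_eq (hkG.symm.trans hc) isOpen_Ioo hGc.continuousOn
      continuousOn_const
  have hc0 : c = 0 := by
    have h5 := hGeq.closure hGc continuous_const
    rw [closure_Ioo hT.ne] at h5
    have h7 : G 0 = c := h5 (left_mem_Icc.2 hT.le)
    rw [← h7, hG]
    simp only [intervalIntegral.integral_same, sub_zero]
    rw [Q.eval_eq y ⟨0, left_mem_Icc.2 hT.le⟩, hy0, map_zero]
  have hk0 : k = 0 := by
    refine Lp.ext ?_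
    filter_upwards [hc, Lp.coeFn_zero V 2 (timeMeasure Q.T)] with t h1 h2
    rw [h1, h2, hc0]
    rfl
  have hw0 := eq_zero_of_parabolic hT.le hα (h σ) (sub_eq_zero.1 (hk.symm.trans hk0))
  rw [hw0, map_zero] at hwy
  have hye : EqOn (Q.eval y) (fun _ => 0) (Ioo 0 Q.T) := by
    refine Measure.eqOn_open_of_ae_eq (μ := volume) ?_ isOpen_Ioo
      (Q.continuous_eval y).continuousOn continuousOn_const
    filter_upwards [coeFn_contLp hT.le y, Lp.coeFn_zero H 2 (timeMeasure Q.T)] with t h1 h2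
    rw [← hwy, h2] at h1
    exact h1.symm
  have h6 := hye.closure (Q.continuous_eval y) continuous_const
  rw [closure_Ioo hT.ne] at h6
  refine sub_eq_zero.1 ?_
  ext t
  exact (Q.eval_eq y t).symm.trans (h6 t.2)

theorem existsUnique_isState (σ : Param) (u : L2 Q.T U) : ∃! y, Q.IsState σ u y :=
  ⟨Q.traj u σ, Q.isState_traj σ u, fun _ hy => hy.unique (Q.isState_traj σ u)⟩

theorem isState_state (u : L2 Q.T U) (σ : Param) : Q.IsState σ u (Q.state u σ) :=
  Classical.epsilon_spec ⟨_, Q.isState_traj σ u⟩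

theorem state_eq_traj (u : L2 Q.T U) : Q.state u = Q.traj u :=
  funext fun σ => (Q.isState_state u σ).unique (Q.isState_traj σ u)

/-- By `solOp_perturb` the difference of two states solves an equation with source `(a' - a) v`; the
constant `M` serves for every `σ`, so the difference is at most `M² ‖a' - a‖ ‖d‖`. -/
theorem continuous_state (u : L2 Q.T U) : Continuous (Q.state u) := by
  obtain ⟨ρ, α, hρ, hα, h⟩ := Q.exists_coercive
  rw [state_eq_traj]
  set M := aprioriConst Q.T α ρ
  have hM : 0 ≤ M := aprioriConst_nonneg hα
  set d := Q.data u
  have hbound : ∀ σ σ', ‖Q.traj u σ' - Q.traj u σ‖ ≤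
      M * (‖Q.opA σ' - Q.opA σ‖ * (M * ‖d‖)) := fun σ σ' => by
    have h1 := solOp_perturb Q.T_pos.le Q.ι_denseRange hα hρ (h σ) (h σ') d
    rw [map_add, ← sub_eq_iff_eq_add'] at h1
    have h2 : Q.traj u σ' - Q.traj u σ = (solOp Q.T_pos.le Q.ι (Q.opA σ)
        (constOp Q.T (Q.opA σ' - Q.opA σ)
          (solOp Q.T_pos.le Q.ι (Q.opA σ') d).1, 0)).2 := by
      rw [← h1]
      rfl
    rw [h2]
    refine (norm_snd_le _).trans
      ((norm_solOp_le Q.T_pos.le Q.ι_denseRange hα hρ (h σ) _).trans ?_)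
    refine mul_le_mul_of_nonneg_left ?_ hM
    rw [Prod.norm_def, norm_zero, max_eq_left (norm_nonneg _)]
    refine ((Q.opA σ' - Q.opA σ).norm_compLp_le _).trans ?_
    gcongr
    exact (norm_fst_le _).trans (norm_solOp_le Q.T_pos.le Q.ι_denseRange hα hρ (h σ') d)
  refine continuous_iff_continuousAt.2 fun σ => tendsto_iff_norm_sub_tendsto_zero.2 ?_
  refine squeeze_zero (fun _ => norm_nonneg _) (hbound σ) ?_
  have h3 : Continuous fun σ' => M * (‖Q.opA σ' - Q.opA σ‖ * (M * ‖d‖)) := by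
    have := Q.continuous_opA
    fun_prop
  have h4 := h3.tendsto σ
  simpa using h4

/-- The solution operator is linear and the data are affine in `u`; `a + b = 1` recombines the fixed
parts `f` and `y₀`. -/
theorem state_convexComb (u w : L2 Q.T U) {a b : ℝ} (hab : a + b = 1) (σ : Param) :
    Q.state (a • u + b • w) σ = a • Q.state u σ + b • Q.state w σ := by
  have h1 : Q.data (a • u + b • w) = a • Q.data u + b • Q.data w := by
    refine Prod.ext ?_ ?_
    · simp only [data, Prod.fst_add, Prod.smul_fst, map_add, map_smul, smul_add]
      rw [add_add_add_comm, ← add_smul, hab, one_smul]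
    · simp only [data, Prod.snd_add, Prod.smul_snd, ← add_smul, hab, one_smul]
  rw [state_eq_traj, state_eq_traj, state_eq_traj, traj, h1, map_add, map_smul, map_smul]
  rfl

theorem exists_lipschitz_state : ∃ K : ℝ, 0 ≤ K ∧ ∀ (u w : L2 Q.T U) (σ : Param),
    ‖Q.state u σ - Q.state w σ‖ ≤ K * ‖u - w‖ := by
  obtain ⟨ρ, α, hρ, hα, h⟩ := Q.exists_coercive
  have hM : 0 ≤ aprioriConst Q.T α ρ := aprioriConst_nonneg hα
  refine ⟨aprioriConst Q.T α ρ * ‖(Q.ι†).comp Q.B‖, by positivity, fun u w σ => ?_⟩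
  have h1 : Q.state u σ - Q.state w σ = (solOp Q.T_pos.le Q.ι (Q.opA σ)
      (constOp Q.T ((Q.ι†).comp Q.B) (u - w), 0)).2 := by
    have : (constOp Q.T ((Q.ι†).comp Q.B) (u - w), (0 : H)) = Q.data u - Q.data w := by
      rw [data, data, Prod.mk_sub_mk, sub_self, map_sub, add_sub_add_right_eq_sub]
    rw [this, map_sub, state_eq_traj, state_eq_traj]
    rfl
  rw [h1]
  refine (norm_snd_le _).trans ((norm_solOp_le Q.T_pos.le Q.ι_denseRange hα hρ (h σ) _).trans ?_)
  rw [Prod.norm_def, norm_zero, max_eq_left (norm_nonneg _), mul_assoc]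
  gcongr
  exact ((Q.ι†).comp Q.B).norm_compLp_le _

end Problem

/-! ### Minimization of strongly convex functions. -/

section Minimizer

/-- Strong convexity at midpoints bounds `‖u - w‖²` by the excess of `f u` and `f w` over the
infimum. Minimizing sequences are therefore Cauchy, so no weak compactness is involved, and
minimizers coincide. -/
theorem existsUnique_minimizer_of_strongConvexOn {X : Type*} [NormedAddCommGroup X]
    [NormedSpace ℝ X] [CompleteSpace X] {f : X → ℝ} {m : ℝ} (hm : 0 < m)
    (hf : StrongConvexOn univ m f) (hc : Continuous f) (hb : BddBelow (range f)) :
    ∃! u, ∀ w, f u ≤ f w := by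
  have hle : ∀ w, ⨅ x, f x ≤ f w := ciInf_le hb
  have hkey : ∀ u w, m / 8 * ‖u - w‖ ^ 2 ≤ 1 / 2 * f u + 1 / 2 * f w - ⨅ x, f x := fun u w => by
    have h := hf.2 (mem_univ u) (mem_univ w) (by norm_num : (0 : ℝ) ≤ 1 / 2)
      (by norm_num : (0 : ℝ) ≤ 1 / 2) (by norm_num)
    have h2 := hle ((1 / 2 : ℝ) • u + (1 / 2 : ℝ) • w)
    simp only [smul_eq_mul] at h
    linarith
  have hseq : ∀ n : ℕ, ∃ u, f u < (⨅ x, f x) + 1 / (n + 1) := fun n =>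
    exists_lt_of_ciInf_lt (by linarith [Nat.one_div_pos_of_nat (α := ℝ) (n := n)])
  choose s hs using hseq
  have hcauchy : CauchySeq s := by
    refine cauchySeq_of_le_tendsto_0 (fun n : ℕ => √(8 / m * (1 / ((n : ℝ) + 1)))) ?_ ?_
    · intro n k N hn hk
      rw [dist_eq_norm]
      refine Real.le_sqrt_of_sq_le ?_
      have h1 := hkey (s n) (s k)
      have h2 : (1 : ℝ) / (n + 1) ≤ 1 / (N + 1) := Nat.one_div_le_one_div hn
      have h3 : (1 : ℝ) / (k + 1) ≤ 1 / (N + 1) := Nat.one_div_le_one_div hk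
      have h4 : m / 8 * ‖s n - s k‖ ^ 2 ≤ 1 / ((N : ℝ) + 1) := by linarith [hs n, hs k]
      calc ‖s n - s k‖ ^ 2 = 8 / m * (m / 8 * ‖s n - s k‖ ^ 2) := by field_simp
        _ ≤ _ := by gcongr
    · have h := (tendsto_one_div_add_atTop_nhds_zero_nat (𝕜 := ℝ)).const_mul (8 / m)
      rw [mul_zero] at h
      have h' := (Real.continuous_sqrt.tendsto _).comp h
      rwa [Real.sqrt_zero] at h'
  obtain ⟨u, hu⟩ := cauchySeq_tendsto_of_complete hcauchy
  have hmin : f u ≤ ⨅ x, f x := by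
    refine le_of_tendsto_of_tendsto' ((hc.tendsto u).comp hu)
      (g := fun n : ℕ => (⨅ x, f x) + 1 / ((n : ℝ) + 1)) ?_ fun n => (hs n).le
    simpa using tendsto_one_div_add_atTop_nhds_zero_nat.const_add (⨅ x, f x)
  refine ⟨u, fun w => hmin.trans (hle w), fun w hw => ?_⟩
  have h1 := hkey w u
  have h2 : f w ≤ f u := hw u
  have h3 : ‖w - u‖ ^ 2 ≤ 0 := by
    by_contra! h
    nlinarith [mul_pos (by positivity : 0 < m / 8) h]
  exact sub_eq_zero.1 (norm_eq_zero.1 (pow_eq_zero_iff two_ne_zero |>.1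
    (le_antisymm h3 (sq_nonneg _))))

end Minimizer

/-! ### The entropic risk measure on continuous random variables. -/

section Entropic

instance : IsProbabilityMeasure paramMeasure := by unfold paramMeasure; infer_instance

variable {θ : ℝ} {X Y : Param → ℝ}

theorem integrable_exp_mul (hX : Continuous X) :
    Integrable (fun σ => Real.exp (θ * X σ)) paramMeasure :=
  Continuous.integrable_of_hasCompactSupport (by fun_prop) (HasCompactSupport.of_compactSpace _)

theorem integral_exp_mul_pos (hX : Continuous X) :
    0 < ∫ σ, Real.exp (θ * X σ) ∂paramMeasure :=
  integral_exp_pos (integrable_exp_mul hX)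

theorem entropicRisk_mono (hθ : 0 < θ) (hX : Continuous X) (hY : Continuous Y)
    (h : ∀ σ, X σ ≤ Y σ) : entropicRisk θ X ≤ entropicRisk θ Y := by
  unfold entropicRisk
  have := integral_exp_mul_pos (θ := θ) hX
  gcongr ?_ * Real.log ?_
  refine integral_mono (integrable_exp_mul hX) (integrable_exp_mul hY) fun σ => ?_
  have := h σ
  simp only
  gcongr

theorem entropicRisk_add_const (hθ : 0 < θ) (hX : Continuous X) (c : ℝ) :
    entropicRisk θ (fun σ => X σ + c) = entropicRisk θ X + c := by
  unfold entropicRisk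
  simp only [mul_add, Real.exp_add]
  rw [integral_mul_const, Real.log_mul (integral_exp_mul_pos hX).ne' (Real.exp_pos _).ne',
    Real.log_exp]
  field_simp

theorem entropicRisk_zero : entropicRisk θ (fun _ => 0) = 0 := by
  simp [entropicRisk]

theorem entropicRisk_nonneg (hθ : 0 < θ) (hX : Continuous X) (h : ∀ σ, 0 ≤ X σ) :
    0 ≤ entropicRisk θ X :=
  entropicRisk_zero.symm.le.trans (entropicRisk_mono hθ continuous_const hX h)

/-- Monotonicity and translation equivariance applied to `X ≤ Y + c` and `Y ≤ X + c`. -/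
theorem abs_entropicRisk_sub_le (hθ : 0 < θ) (hX : Continuous X) (hY : Continuous Y) {c : ℝ}
    (h : ∀ σ, |X σ - Y σ| ≤ c) : |entropicRisk θ X - entropicRisk θ Y| ≤ c := by
  rw [abs_sub_le_iff, sub_le_iff_le_add', sub_le_iff_le_add',
    ← entropicRisk_add_const hθ hX, ← entropicRisk_add_const hθ hY]
  exact ⟨entropicRisk_mono hθ hX (hY.add continuous_const) fun σ => by
      linarith [(abs_sub_le_iff.1 (h σ)).1],
    entropicRisk_mono hθ hY (hX.add continuous_const) fun σ => by
      linarith [(abs_sub_le_iff.1 (h σ)).2]⟩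

theorem entropicRisk_convex (hθ : 0 < θ) (hX : Continuous X) (hY : Continuous Y) {a b : ℝ}
    (ha : 0 ≤ a) (hb : 0 ≤ b) (hab : a + b = 1) :
    entropicRisk θ (fun σ => a * X σ + b * Y σ) ≤
      a * entropicRisk θ X + b * entropicRisk θ Y := by
  -- Subtracting its risk normalizes a variable to exponential moment 1. Convexity of `exp` then
  -- bounds that of the combination by 1, so its risk, shifted by `-r`, is nonpositive.
  have hc : ∀ Z : Param → ℝ, Continuous Z →
      ∫ σ, Real.exp (θ * (Z σ - entropicRisk θ Z)) ∂paramMeasure = 1 := fun Z hZ => by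
    have h1 : θ * entropicRisk θ Z = Real.log (∫ σ, Real.exp (θ * Z σ) ∂paramMeasure) := by
      unfold entropicRisk
      field_simp
    simp only [mul_sub, Real.exp_sub]
    rw [integral_div, h1, Real.exp_log (integral_exp_mul_pos hZ),
      div_self (integral_exp_mul_pos hZ).ne']
  set r := a * entropicRisk θ X + b * entropicRisk θ Y with hr
  have hXi : Integrable (fun σ => Real.exp (θ * (X σ - entropicRisk θ X))) paramMeasure :=
    integrable_exp_mul (hX.sub continuous_const)
  have hYi : Integrable (fun σ => Real.exp (θ * (Y σ - entropicRisk θ Y))) paramMeasure :=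
    integrable_exp_mul (hY.sub continuous_const)
  have hZ : Continuous fun σ => a * X σ + b * Y σ := by fun_prop
  have h2 : ∫ σ, Real.exp (θ * (a * X σ + b * Y σ + -r)) ∂paramMeasure ≤ 1 := by
    calc ∫ σ, Real.exp (θ * (a * X σ + b * Y σ + -r)) ∂paramMeasure
        ≤ ∫ σ, (a * Real.exp (θ * (X σ - entropicRisk θ X)) +
          b * Real.exp (θ * (Y σ - entropicRisk θ Y))) ∂paramMeasure := by
          refine integral_mono (integrable_exp_mul (hZ.add continuous_const))
            ((hXi.const_mul a).add (hYi.const_mul b)) fun σ => ?_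
          have h3 := convexOn_exp.2 (mem_univ (θ * (X σ - entropicRisk θ X)))
            (mem_univ (θ * (Y σ - entropicRisk θ Y))) ha hb hab
          simp only [smul_eq_mul] at h3
          refine le_trans (le_of_eq ?_) h3
          congr 1
          rw [hr]
          ring
      _ = 1 := by
          rw [integral_add (hXi.const_mul a) (hYi.const_mul b), integral_const_mul,
            integral_const_mul, hc X hX, hc Y hY, mul_one, mul_one, hab]
  have h4 : entropicRisk θ (fun σ => a * X σ + b * Y σ + -r) ≤ 0 := by
    refine mul_nonpos_of_nonneg_of_nonpos (by positivity) (Real.log_nonpos ?_ h2)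
    exact (integral_exp_mul_pos (hZ.add continuous_const)).le
  rw [entropicRisk_add_const hθ hZ] at h4
  linarith

end Entropic

/-! ### Properties of the reduced cost and existence of optimal controls. -/

namespace Problem

variable {U V H : Type*}
  [NormedAddCommGroup U] [InnerProductSpace ℝ U]
  [NormedAddCommGroup V] [InnerProductSpace ℝ V] [CompleteSpace V]
  [NormedAddCommGroup H] [InnerProductSpace ℝ H] [CompleteSpace H]
  (Q : Problem U V H)

/-- The squared distance of the observed state to the observed target. -/
noncomputable def misfit (D : H →L[ℝ] H) (u : L2 Q.T U) (t : ℝ) (z : H) (σ : Param) : ℝ :=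
  ‖D (Q.eval (Q.state u σ) t - z)‖ ^ 2

theorem continuous_eval_state (u : L2 Q.T U) :
    Continuous fun p : ℝ × Param => Q.eval (Q.state u p.2) p.1 :=
  ((Q.continuous_state u).comp continuous_snd).eval (continuous_projIcc.comp continuous_fst)

theorem continuous_misfit (D : H →L[ℝ] H) (u : L2 Q.T U) (t : ℝ) (z : H) :
    Continuous (Q.misfit D u t z) := by
  have h : Continuous fun σ => Q.eval (Q.state u σ) t :=
    (continuous_eval_const (Set.projIcc 0 Q.T Q.T_pos.le t)).comp (Q.continuous_state u)
  change Continuous fun σ => ‖D (Q.eval (Q.state u σ) t - z)‖ ^ 2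
  fun_prop

omit [CompleteSpace V] [CompleteSpace H] in
theorem misfit_nonneg (D : H →L[ℝ] H) (u : L2 Q.T U) (t : ℝ) (z : H) (σ : Param) :
    0 ≤ Q.misfit D u t z σ := sq_nonneg _

omit [CompleteSpace V] [CompleteSpace H] in
theorem eval_add_smul (y z : C(Set.Icc (0 : ℝ) Q.T, H)) (a b t : ℝ) :
    Q.eval (a • y + b • z) t = a • Q.eval y t + b • Q.eval z t := rfl

omit [CompleteSpace V] [CompleteSpace H] in
theorem norm_eval_sub_le (y z : C(Set.Icc (0 : ℝ) Q.T, H)) (t : ℝ) :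
    ‖Q.eval y t - Q.eval z t‖ ≤ ‖y - z‖ :=
  (y - z).norm_coe_le_norm (Set.projIcc 0 Q.T Q.T_pos.le t)

omit [CompleteSpace V] [CompleteSpace H] in
theorem norm_eval_le (y : C(Set.Icc (0 : ℝ) Q.T, H)) (t : ℝ) : ‖Q.eval y t‖ ≤ ‖y‖ :=
  y.norm_coe_le_norm (Set.projIcc 0 Q.T Q.T_pos.le t)

theorem misfit_convex (D : H →L[ℝ] H) (u w : L2 Q.T U) (t : ℝ) (z : H) {a b : ℝ}
    (ha : 0 ≤ a) (hb : 0 ≤ b) (hab : a + b = 1) (σ : Param) :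
    Q.misfit D (a • u + b • w) t z σ ≤ a * Q.misfit D u t z σ + b * Q.misfit D w t z σ := by
  have h1 : D (Q.eval (Q.state (a • u + b • w) σ) t - z) =
      a • D (Q.eval (Q.state u σ) t - z) + b • D (Q.eval (Q.state w σ) t - z) := by
    rw [state_convexComb Q u w hab, eval_add_smul, ← map_smul, ← map_smul, ← map_add]
    congr 1
    nth_rewrite 1 [← one_smul ℝ z]
    rw [← hab, add_smul, smul_sub, smul_sub]
    abel
  unfold misfit
  rw [h1]
  set p := D (Q.eval (Q.state u σ) t - z)
  set q := D (Q.eval (Q.state w σ) t - z)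
  have h2 : ‖a • p + b • q‖ ≤ a * ‖p‖ + b * ‖q‖ := by
    refine (norm_add_le _ _).trans (le_of_eq ?_)
    rw [norm_smul, norm_smul, Real.norm_of_nonneg ha, Real.norm_of_nonneg hb]
  refine (pow_le_pow_left₀ (norm_nonneg _) h2 2).trans ?_
  obtain rfl : b = 1 - a := by linarith
  nlinarith [mul_nonneg (mul_nonneg ha hb) (sq_nonneg (‖p‖ - ‖q‖))]

theorem risk_misfit_convex (D : H →L[ℝ] H) (u w : L2 Q.T U) (t : ℝ) (z : H) {a b : ℝ}
    (ha : 0 ≤ a) (hb : 0 ≤ b) (hab : a + b = 1) :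
    entropicRisk Q.θ (Q.misfit D (a • u + b • w) t z) ≤
      a * entropicRisk Q.θ (Q.misfit D u t z) + b * entropicRisk Q.θ (Q.misfit D w t z) :=
  (entropicRisk_mono Q.θ_pos (Q.continuous_misfit D _ t z)
    (((Q.continuous_misfit D u t z).const_mul a).add ((Q.continuous_misfit D w t z).const_mul b))
    (Q.misfit_convex D u w t z ha hb hab)).trans
    (entropicRisk_convex Q.θ_pos (Q.continuous_misfit D u t z) (Q.continuous_misfit D w t z)
      ha hb hab)

theorem exists_norm_state_le (u : L2 Q.T U) : ∃ m : ℝ, ∀ σ, ‖Q.state u σ‖ ≤ m := by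
  obtain ⟨m, hm⟩ := isCompact_univ.exists_bound_of_continuousOn
    (Q.continuous_state u).continuousOn
  exact ⟨m, fun σ => hm σ (mem_univ σ)⟩

/-- Local Lipschitz bound for the risk of the misfit, uniform in time and in bounded targets. -/
theorem exists_modulus (D : H →L[ℝ] H) (u : L2 Q.T U) (r : ℝ) :
    ∃ K L : ℝ, ∀ (w : L2 Q.T U) (t : ℝ) (z : H), ‖z‖ ≤ r →
      |entropicRisk Q.θ (Q.misfit D w t z) - entropicRisk Q.θ (Q.misfit D u t z)| ≤
        L * ‖w - u‖ * (K + L * ‖w - u‖) := by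
  obtain ⟨m, hm⟩ := Q.exists_norm_state_le u
  obtain ⟨L, hL0, hL⟩ := Q.exists_lipschitz_state
  -- From `‖q‖² - ‖p‖² = (‖q‖ - ‖p‖)(‖q‖ + ‖p‖)`: the first factor is at most `‖D‖ L ‖w - u‖`, and
  -- `K` bounds `2 ‖p‖`.
  refine ⟨2 * (‖D‖ * (m + r)), ‖D‖ * L, fun w t z hz =>
    abs_entropicRisk_sub_le Q.θ_pos (Q.continuous_misfit D w t z) (Q.continuous_misfit D u t z)
      fun σ => ?_⟩
  unfold misfit
  set p := D (Q.eval (Q.state u σ) t - z) with hp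
  set q := D (Q.eval (Q.state w σ) t - z) with hq
  have h1 : ‖q - p‖ ≤ ‖D‖ * L * ‖w - u‖ := by
    rw [hp, hq, ← map_sub, sub_sub_sub_cancel_right, mul_assoc]
    refine (D.le_opNorm _).trans ?_
    gcongr
    exact (Q.norm_eval_sub_le _ _ t).trans (hL w u σ)
  have h2 : ‖p‖ ≤ ‖D‖ * (m + r) := by
    refine (D.le_opNorm _).trans ?_
    gcongr
    exact (norm_sub_le _ _).trans (add_le_add ((Q.norm_eval_le _ t).trans (hm σ)) hz)
  have h3 : |‖q‖ - ‖p‖| ≤ ‖q - p‖ := abs_norm_sub_norm_le q p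
  have h4 : ‖q‖ + ‖p‖ ≤ 2 * (‖D‖ * (m + r)) + ‖D‖ * L * ‖w - u‖ := by
    linarith [(abs_le.1 h3).2]
  have h5 : ‖q‖ ^ 2 - ‖p‖ ^ 2 = (‖q‖ - ‖p‖) * (‖q‖ + ‖p‖) := by ring
  rw [h5, abs_mul, abs_of_nonneg (by positivity : 0 ≤ ‖q‖ + ‖p‖)]
  exact mul_le_mul (h3.trans h1) h4 (by positivity) ((norm_nonneg _).trans h1)

/-- The running risk. -/
noncomputable def runningRisk (u : L2 Q.T U) (t : ℝ) : ℝ :=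
  entropicRisk Q.θ (Q.misfit Q.C u t (Q.eval Q.g t))

/-- The terminal risk. -/
noncomputable def terminalRisk (u : L2 Q.T U) : ℝ :=
  entropicRisk Q.θ (Q.misfit Q.P u Q.T Q.gT)

/-- The integrand is jointly continuous in time and parameter, and the parameter space is compact.
-/
theorem continuous_runningRisk (u : L2 Q.T U) : Continuous (Q.runningRisk u) := by
  have h1 : Continuous fun p : ℝ × Param =>
      Real.exp (Q.θ * Q.misfit Q.C u p.1 (Q.eval Q.g p.1) p.2) := by
    refine Real.continuous_exp.comp (continuous_const.mul
      ((Q.C.continuous.comp ((Q.continuous_eval_state u).sub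
        ((Q.continuous_eval Q.g).comp continuous_fst))).norm.pow 2))
  have h2 := continuous_parametric_integral_of_continuous (μ := paramMeasure)
    (f := fun t σ => Real.exp (Q.θ * Q.misfit Q.C u t (Q.eval Q.g t) σ)) h1 isCompact_univ
  rw [Measure.restrict_univ] at h2
  exact continuous_const.mul
    (h2.log fun t => (integral_exp_mul_pos (Q.continuous_misfit Q.C u t _)).ne')

theorem integrable_runningRisk (u : L2 Q.T U) :
    Integrable (Q.runningRisk u) (timeMeasure Q.T) :=
  ((Q.continuous_runningRisk u).continuousOn.integrableOn_compact isCompact_Icc).mono_set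
    Ioo_subset_Icc_self

omit [CompleteSpace V] [CompleteSpace H] in
theorem integrable_norm_sq (u : L2 Q.T U) :
    Integrable (fun t => ‖u t‖ ^ 2) (timeMeasure Q.T) := by
  simpa only [real_inner_self_eq_norm_sq] using L2.integrable_inner (𝕜 := ℝ) u u

omit [CompleteSpace V] [CompleteSpace H] in
theorem integral_norm_sq (u : L2 Q.T U) : ∫ t in Ioo 0 Q.T, ‖u t‖ ^ 2 = ‖u‖ ^ 2 := by
  rw [← real_inner_self_eq_norm_sq, L2.inner_def]
  simp only [real_inner_self_eq_norm_sq]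

theorem integrable_runningCost (u : L2 Q.T U) :
    Integrable (Q.runningCost u (Q.state u)) (timeMeasure Q.T) :=
  (Q.integrable_runningRisk u).add (Q.integrable_norm_sq u)

theorem reducedCost_eq (u : L2 Q.T U) : Q.reducedCost u =
    1 / 2 * ((∫ t in Ioo 0 Q.T, Q.runningRisk u t) + ‖u‖ ^ 2 + Q.terminalRisk u) := by
  rw [← integral_norm_sq, ← integral_add (Q.integrable_runningRisk u) (Q.integrable_norm_sq u)]
  rfl

theorem le_reducedCost (u : L2 Q.T U) : 1 / 2 * ‖u‖ ^ 2 ≤ Q.reducedCost u := by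
  have h1 : 0 ≤ ∫ t in Ioo 0 Q.T, Q.runningRisk u t := integral_nonneg fun t =>
    entropicRisk_nonneg Q.θ_pos (Q.continuous_misfit _ _ _ _) (Q.misfit_nonneg _ _ _ _)
  have h2 : 0 ≤ Q.terminalRisk u :=
    entropicRisk_nonneg Q.θ_pos (Q.continuous_misfit _ _ _ _) (Q.misfit_nonneg _ _ _ _)
  rw [reducedCost_eq]
  linarith

/-- The risk terms are merely convex; the modulus comes from the exact identity `h3` for `‖u‖²`. -/
theorem strongConvexOn_reducedCost : StrongConvexOn univ 1 Q.reducedCost := by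
  refine ⟨convex_univ, fun u _ w _ a b ha hb hab => ?_⟩
  have h1 : ∫ t in Ioo 0 Q.T, Q.runningRisk (a • u + b • w) t ≤
      a * (∫ t in Ioo 0 Q.T, Q.runningRisk u t) + b * ∫ t in Ioo 0 Q.T, Q.runningRisk w t := by
    rw [← integral_const_mul, ← integral_const_mul,
      ← integral_add ((Q.integrable_runningRisk u).const_mul a)
        ((Q.integrable_runningRisk w).const_mul b)]
    exact integral_mono (Q.integrable_runningRisk _) (((Q.integrable_runningRisk u).const_mul a).add
        ((Q.integrable_runningRisk w).const_mul b)) fun t =>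
      Q.risk_misfit_convex Q.C u w t _ ha hb hab
  have h2 : Q.terminalRisk (a • u + b • w) ≤ a * Q.terminalRisk u + b * Q.terminalRisk w :=
    Q.risk_misfit_convex Q.P u w Q.T Q.gT ha hb hab
  have h3 : ‖a • u + b • w‖ ^ 2 = a * ‖u‖ ^ 2 + b * ‖w‖ ^ 2 - a * b * ‖u - w‖ ^ 2 := by
    rw [norm_add_sq_real, norm_sub_sq_real, norm_smul, norm_smul, Real.norm_of_nonneg ha,
      Real.norm_of_nonneg hb, inner_smul_left, inner_smul_right]
    obtain rfl : b = 1 - a := by linarith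
    simp only [conj_trivial]
    ring
  simp only [smul_eq_mul, reducedCost_eq, h3]
  linarith

theorem continuous_reducedCost : Continuous Q.reducedCost := by
  have hmod : ∀ (u : L2 Q.T U) (K L : ℝ),
      Filter.Tendsto (fun w => L * ‖w - u‖ * (K + L * ‖w - u‖)) (𝓝 u) (𝓝 0) := fun u K L => by
    have h : Continuous fun w : L2 Q.T U => L * ‖w - u‖ * (K + L * ‖w - u‖) := by fun_prop
    simpa using h.tendsto u
  have hterm : Continuous Q.terminalRisk := continuous_iff_continuousAt.2 fun u => by
    obtain ⟨K, L, h⟩ := Q.exists_modulus Q.P u ‖Q.gT‖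
    refine tendsto_iff_norm_sub_tendsto_zero.2
      (squeeze_zero (fun _ => norm_nonneg _) (fun w => h w Q.T Q.gT le_rfl) (hmod u K L))
  have hrun : Continuous fun u : L2 Q.T U => ∫ t in Ioo 0 Q.T, Q.runningRisk u t :=
    continuous_iff_continuousAt.2 fun u => by
      -- The bound `‖g‖` on the targets holds at all times, so one modulus serves under the time
      -- integral.
      obtain ⟨K, L, h⟩ := Q.exists_modulus Q.C u ‖Q.g‖
      have h1 := (hmod u K L).mul_const ((timeMeasure Q.T).real univ)
      rw [zero_mul] at h1
      refine tendsto_iff_norm_sub_tendsto_zero.2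
        (squeeze_zero (fun _ => norm_nonneg _) (fun w => ?_) h1)
      rw [← integral_sub (Q.integrable_runningRisk w) (Q.integrable_runningRisk u)]
      exact norm_integral_le_of_norm_le_const
        (Filter.Eventually.of_forall fun t => h w t _ (Q.norm_eval_le Q.g t))
  have : Q.reducedCost = fun u =>
    1 / 2 * ((∫ t in Ioo 0 Q.T, Q.runningRisk u t) + ‖u‖ ^ 2 + Q.terminalRisk u) :=
    funext Q.reducedCost_eq
  rw [this]
  fun_prop

theorem existsUnique_minimizer [CompleteSpace U] :
    ∃! u : L2 Q.T U, ∀ w : L2 Q.T U, Q.reducedCost u ≤ Q.reducedCost w :=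
  existsUnique_minimizer_of_strongConvexOn one_pos Q.strongConvexOn_reducedCost
    Q.continuous_reducedCost ⟨0, by
      rintro _ ⟨u, rfl⟩
      exact le_trans (by positivity) (Q.le_reducedCost u)⟩

/-- Uniqueness of states makes the feasible set the graph of `Q.state`, which reduces the problem in
pairs to minimizing `J`. -/
theorem feasible_iff (p : L2 Q.T U × (Param → C(Set.Icc (0 : ℝ) Q.T, H))) :
    Q.Feasible p ↔ p.2 = Q.state p.1 :=
  ⟨fun h => funext fun σ => (h σ).unique (Q.isState_state p.1 σ),
    fun h σ => h ▸ Q.isState_state p.1 σ⟩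

theorem existsUnique_optimal [CompleteSpace U] :
    ∃! p, Q.Feasible p ∧ ∀ q, Q.Feasible q → Q.cost p.1 p.2 ≤ Q.cost q.1 q.2 := by
  obtain ⟨u, hu, huniq⟩ := Q.existsUnique_minimizer
  refine ⟨(u, Q.state u), ⟨(Q.feasible_iff _).2 rfl, fun q hq => ?_⟩, fun p ⟨hp, hmin⟩ => ?_⟩
  · rw [(Q.feasible_iff q).1 hq]
    exact hu q.1
  · have h1 := (Q.feasible_iff p).1 hp
    have h2 : p.1 = u := huniq p.1 fun w => by
      have := hmin (w, Q.state w) ((Q.feasible_iff _).2 rfl)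
      rwa [h1] at this
    exact Prod.ext h2 (by rw [h1, h2])

end Problem

end RiskAverse

theorem mainTheorem3
    {U V H : Type*}
    [NormedAddCommGroup U] [InnerProductSpace ℝ U] [CompleteSpace U]
    [TopologicalSpace.SeparableSpace U]
    [NormedAddCommGroup V] [InnerProductSpace ℝ V] [CompleteSpace V]
    [TopologicalSpace.SeparableSpace V]
    [NormedAddCommGroup H] [InnerProductSpace ℝ H] [CompleteSpace H]
    [TopologicalSpace.SeparableSpace H]
    (Q : RiskAverse.Problem U V H) :
    -- the state equation is uniquely solvable, and the state depends continuously on `σ`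
    (∀ (σ : RiskAverse.Param) (u : RiskAverse.L2 Q.T U), ∃! y, Q.IsState σ u y) ∧
    (∀ u : RiskAverse.L2 Q.T U, Continuous (Q.state u)) ∧
    -- the integrals defining `J` exist
    (∀ (u : RiskAverse.L2 Q.T U) (t : ℝ), MeasureTheory.Integrable
      (fun σ => Real.exp (Q.θ * ‖Q.C (Q.eval (Q.state u σ) t - Q.eval Q.g t)‖ ^ 2))
      RiskAverse.paramMeasure) ∧
    (∀ u : RiskAverse.L2 Q.T U, MeasureTheory.Integrable
      (fun σ => Real.exp (Q.θ * ‖Q.P (Q.eval (Q.state u σ) Q.T - Q.gT)‖ ^ 2))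
      RiskAverse.paramMeasure) ∧
    (∀ u : RiskAverse.L2 Q.T U,
      MeasureTheory.IntegrableOn (Q.runningCost u (Q.state u)) (Set.Ioo 0 Q.T)) ∧
    -- `J` is continuous, coercive and strongly convex
    Continuous Q.reducedCost ∧
    (∀ u : RiskAverse.L2 Q.T U, 1 / 2 * ‖u‖ ^ 2 ≤ Q.reducedCost u) ∧
    StrongConvexOn Set.univ 1 Q.reducedCost ∧
    -- `J` has a unique minimizer
    (∃! u : RiskAverse.L2 Q.T U, ∀ w : RiskAverse.L2 Q.T U, Q.reducedCost u ≤ Q.reducedCost w) ∧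
    -- the original problem has a unique solution
    (∃! p, Q.Feasible p ∧ ∀ q, Q.Feasible q → Q.cost p.1 p.2 ≤ Q.cost q.1 q.2) := by
  exact ⟨Q.existsUnique_isState, Q.continuous_state,
    fun u t => RiskAverse.integrable_exp_mul (Q.continuous_misfit Q.C u t (Q.eval Q.g t)),
    fun u => RiskAverse.integrable_exp_mul (Q.continuous_misfit Q.P u Q.T Q.gT),
    Q.integrable_runningCost, Q.continuous_reducedCost, Q.le_reducedCost,
    Q.strongConvexOn_reducedCost, Q.existsUnique_minimizer, Q.existsUnique_optimal⟩
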